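/- Let $A\in\mathbb R^{n\times n}$, $B\in\mathbb R^{n\times m}$, $C\in\mathbb R^{l\times n}$ have relative degree $r\ge2$, i.e. $CA^iB=0$ for $i=0,\dots,r-2$ and $CA^{r-1}B\neq0$. Let $h>0$ (sampling period), $t_k=kh$ for $k=0,1,2,\dots$, let $0<q_1<\dots<q_{r-1}$ be integers (discrete-time delays), put $q_0=0$, and let $K_0,\dots,K_{r-1}\in\mathbb R^{m\times l}$ (gains), $\sigma\in[0,1)$ (triggering threshold) and $\alpha>0$ (decay rate). Suppose that there are symmetric positive-definite matrices $P\in\mathbb R^{n\times n}$ and $\Omega,W_0,\dots,W_{r-1},R_1,\dots,R_{r-1}\in\mathbb R^{m\times m}$ such that the symmetric matrix $$\Phi_e=\begin{bmatrix} \Phi_{11}&\Phi_{12}&\Phi_{13}&\Phi_{14}&PB&\sigma F^T\Omega\\ *&\Phi_{22}&0&\Phi_{24}&0&\sigma\mathbf 1_r\otimes\Omega\\ *&*&\Phi_{33}&\Phi_{34}&0&\sigma\mathbf 1_{r-1}\otimes\Omega\\ *&*&*&\Phi_{44}&HCA^{r-1}B&0\\ *&*&*&*&-\Omega&0\\ *&*&*&*&*&-\sigma\Omega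 \end{bmatrix}$$ is negative semidefinite ($\Phi_e\le0$). Here $\mathbf 1_j=[1,\dots,1]^T\in\mathbb R^j$, $\otimes$ is the Kronecker product, $F=[K_0,K_1,\dots,K_{r-1}]M\bar C$, where $M$ is the $rl\times rl$ matrix with blocks $\frac{(-q_ih)^j}{j!}I_l$, $i,j=0,\dots,r-1$ (with $0^0=1$, so that its first block row is $[I_l,0,\dots,0]$), and $\bar C$ is the block column with blocks $C,CA,\dots,CA^{r-1}$; further $D=A+BF$, $H=\sum_{i=1}^{r-1}(q_ih)^rK_i^TR_iK_i$, and $$\begin{aligned} \Phi_{11}&=PD+D^TP+2\alpha P+h^2e^{2\alpha h}\sum_{i=0}^{r-1}(K_iCA)^TW_i(K_iCA),\\ \Phi_{12}&=\mathbf 1_r^T\otimes PB,\qquad \Phi_{13}=\mathbf 1_{r-1}^T\otimes PB,\qquad \Phi_{14}=(CA^{r-1}D)^TH,\\ \Phi_{22}&=-\tfrac{\pi^2}{4}\operatorname{diag}\{W_0,e^{-2\alpha q_1h}W_1,\dots,e^{-2\alpha q_{r-1}h}W_{r-1}\},\qquad \Phi_{24}=\mathbf 1_r\otimes(CA^{r-1}B)^TH,\\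 \Phi_{33}&=-(r!)^2\operatorname{diag}\Bigl\{\tfrac{e^{-2\alpha q_1h}}{(q_1h)^r}R_1,\dots,\tfrac{e^{-2\alpha q_{r-1}h}}{(q_{r-1}h)^r}R_{r-1}\Bigr\},\qquad \Phi_{34}=\mathbf 1_{r-1}\otimes(CA^{r-1}B)^TH,\qquad \Phi_{44}=-H. \end{aligned}$$ Consider the closed loop $$\dot x(t)=Ax(t)+B\hat u_k,\quad t\in[t_k,t_{k+1}),\qquad y(t)=Cx(t)\ (t\ge0),\quad y(t)=0\ (t<0),\qquad u(t_k)=K_0y(t_k)+\sum_{i=1}^{r-1}K_iy(t_k-q_ih),$$ where $x$ is continuous on $[0,\infty)$, $\hat u_0=u(t_0)$ and, for $k\ge1$, $\hat u_k=u(t_k)$ if $$(u(t_k)-\hat u_{k-1})^T\Omega(u(t_k)-\hat u_{k-1})>\sigma u(t_k)^T\Omega u(t_k),$$ and $\hat u_k=\hat u_{k-1}$ otherwise. Then this event-triggered controller exponentially stabilizes the system with decay rate $\alpha$: there is a constant $c>0$ such that for every initial state $x(0)\in\mathbb R^n$ the closed loop has a solution on $[0,\infty)$, and every solution satisfies $|x(t)|\le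 c\,e^{-\alpha t}|x(0)|$ for all $t\ge0$. -/

import Mathlib

open scoped Matrix

noncomputable section

namespace EventTriggered

/-! Throughout, `s = r - 1 ≥ 1` is the number of delayed samples used by the controller, where
`r = s + 1` is the relative degree.  The gains are `K 0, …, K s`, and `q i` (`i : Fin s`) is the
`(i+1)`-st discrete-time delay, so that the gain that goes with it is `K i.succ`. -/

/-- `ẋ = A x + B u`, `y = C x` has relative degree `r`:
`C A ^ i B = 0` for `i = 0, …, r - 2` and `C A ^ (r - 1) B ≠ 0`. -/
def HasRelativeDegree {n m l : ℕ} (A : Matrix (Fin n) (Fin n) ℝ) (B : Matrix (Fin n) (Fin m) ℝ)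
    (C : Matrix (Fin l) (Fin n) ℝ) (r : ℕ) : Prop :=
  (∀ i : ℕ, i + 2 ≤ r → C * A ^ i * B = 0) ∧ C * A ^ (r - 1) * B ≠ 0

/-! ### The closed loop -/

/-- The output `y(t) = C x(t)`, with the convention `y(t) = 0` for `t < 0`. -/
def output {n l : ℕ} (C : Matrix (Fin l) (Fin n) ℝ) (x : ℝ → Fin n → ℝ) (t : ℝ) : Fin l → ℝ :=
  if t < 0 then 0 else C *ᵥ x t

/-- The control signal `u(t_k) = K₀ y(t_k) + ∑ᵢ Kᵢ y(t_k - qᵢ h)` at `t_k = k h`. -/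
def control {n m l s : ℕ} (C : Matrix (Fin l) (Fin n) ℝ)
    (K : Fin (s + 1) → Matrix (Fin m) (Fin l) ℝ) (q : Fin s → ℕ) (h : ℝ)
    (x : ℝ → Fin n → ℝ) (k : ℕ) : Fin m → ℝ :=
  K 0 *ᵥ output C x (k * h) + ∑ i : Fin s, K i.succ *ᵥ output C x (k * h - q i * h)

/-- The event-triggering rule: given that `û` is the signal transmitted last, the signal `u` is
transmitted if and only if `(u - û)ᵀ Ω (u - û) > σ uᵀ Ω u`. -/
def Triggered {m : ℕ} (Ω : Matrix (Fin m) (Fin m) ℝ) (σ : ℝ) (u û : Fin m → ℝ) : Prop :=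
  (u - û) ⬝ᵥ (Ω *ᵥ (u - û)) > σ * (u ⬝ᵥ (Ω *ᵥ u))

/-- `x` (on `[0, ∞)`) and the applied control values `û 0, û 1, …` solve the closed loop:
`x` is continuous, `ẋ(t) = A x(t) + B û_k` on `[t_k, t_{k+1})` (a right derivative at `t_k`,
a two-sided one inside), `û_0 = u(t_0)`, and `û_{k+1}` is `u(t_{k+1})` or `û_k` according to
the event-triggering rule. -/
structure IsTrajectory {n m l s : ℕ} (A : Matrix (Fin n) (Fin n) ℝ)
    (B : Matrix (Fin n) (Fin m) ℝ) (C : Matrix (Fin l) (Fin n) ℝ)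
    (K : Fin (s + 1) → Matrix (Fin m) (Fin l) ℝ) (q : Fin s → ℕ) (h : ℝ)
    (Ω : Matrix (Fin m) (Fin m) ℝ) (σ : ℝ)
    (x : ℝ → Fin n → ℝ) (û : ℕ → Fin m → ℝ) : Prop where
  continuousOn : ContinuousOn x (Set.Ici 0)
  hasDeriv : ∀ k : ℕ, ∀ t ∈ Set.Ico ((k : ℝ) * h) (((k : ℝ) + 1) * h),
    HasDerivWithinAt x (A *ᵥ x t + B *ᵥ û k) (Set.Ici ((k : ℝ) * h)) t
  init : û 0 = control C K q h x 0
  transmit : ∀ k : ℕ, Triggered Ω σ (control C K q h x (k + 1)) (û k) →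
    û (k + 1) = control C K q h x (k + 1)
  hold : ∀ k : ℕ, ¬ Triggered Ω σ (control C K q h x (k + 1)) (û k) → û (k + 1) = û k

/-- The Euclidean norm of a vector. -/
def euclNorm {n : ℕ} (v : Fin n → ℝ) : ℝ := ‖(WithLp.toLp 2 v : EuclideanSpace ℝ (Fin n))‖

/-- The event-triggered controller exponentially stabilizes the system with decay rate `α`:
there is a constant `c`, independent of the initial state, such that from each initial state
the closed loop has a solution on `[0, ∞)`, and every such solution satisfies
`|x(t)| ≤ c e^{-α t} |x(0)|` for all `t ≥ 0`. -/
def ExponentiallyStabilizes {n m l s : ℕ} (A : Matrix (Fin n) (Fin n) ℝ)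
    (B : Matrix (Fin n) (Fin m) ℝ) (C : Matrix (Fin l) (Fin n) ℝ)
    (K : Fin (s + 1) → Matrix (Fin m) (Fin l) ℝ) (q : Fin s → ℕ) (h : ℝ)
    (Ω : Matrix (Fin m) (Fin m) ℝ) (σ α : ℝ) : Prop :=
  ∃ c : ℝ, 0 < c ∧ ∀ x₀ : Fin n → ℝ,
    (∃ (x : ℝ → Fin n → ℝ) (û : ℕ → Fin m → ℝ),
      IsTrajectory A B C K q h Ω σ x û ∧ x 0 = x₀) ∧
    ∀ (x : ℝ → Fin n → ℝ) (û : ℕ → Fin m → ℝ),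
      IsTrajectory A B C K q h Ω σ x û → x 0 = x₀ →
      ∀ t : ℝ, 0 ≤ t → euclNorm (x t) ≤ c * Real.exp (-α * t) * euclNorm x₀

/-! ### The matrices of the LMI

A block vector with blocks `v i` (`i : ι`) of length `m` has the index type `ι × Fin m`. -/

/-- `1 ⊗ X`: the block column all of whose blocks, indexed by `ι`, are `X`. -/
def repCol (ι : Type) {a b : Type} (X : Matrix a b ℝ) : Matrix (ι × a) b ℝ :=
  Matrix.of fun p j => X p.2 j

/-- `1ᵀ ⊗ X`: the block row all of whose blocks, indexed by `ι`, are `X`. -/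
def repRow (ι : Type) {a b : Type} (X : Matrix a b ℝ) : Matrix a (ι × b) ℝ :=
  Matrix.of fun i p => X i p.2

/-- `diag {X i}`, the block diagonal matrix with diagonal blocks `X i`. -/
def blockDiag {ι a : Type} [DecidableEq ι] (X : ι → Matrix a a ℝ) : Matrix (ι × a) (ι × a) ℝ :=
  Matrix.of fun p p' => if p.1 = p'.1 then X p.1 p.2 p'.2 else 0

/-- The delays `q₀ = 0, q₁, …, q_{r-1}`. -/
def delay {s : ℕ} (q : Fin s → ℕ) : Fin (s + 1) → ℕ := Fin.cons 0 q

/-- The matrix `M` with blocks `((-qᵢ h)ʲ / j!) I_l` for `i, j = 0, …, r - 1`, where `q₀ = 0`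
(so its block row number `0` is `[I_l, 0, …, 0]`). -/
def matM {s : ℕ} (l : ℕ) (q : Fin s → ℕ) (h : ℝ) :
    Matrix (Fin (s + 1) × Fin l) (Fin (s + 1) × Fin l) ℝ :=
  Matrix.of fun p p' =>
    if p.2 = p'.2 then (-(delay q p.1 * h)) ^ (p'.1 : ℕ) / ((p'.1 : ℕ).factorial : ℝ) else 0

/-- The block row `[K₀, K₁, …, K_{r-1}]`. -/
def matK {m l s : ℕ} (K : Fin (s + 1) → Matrix (Fin m) (Fin l) ℝ) :
    Matrix (Fin m) (Fin (s + 1) × Fin l) ℝ :=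
  Matrix.of fun a p => K p.1 a p.2

/-- The block column `col {C, C A, …, C A ^ (r - 1)}`. -/
def matCbar {n l : ℕ} (s : ℕ) (A : Matrix (Fin n) (Fin n) ℝ) (C : Matrix (Fin l) (Fin n) ℝ) :
    Matrix (Fin (s + 1) × Fin l) (Fin n) ℝ :=
  Matrix.of fun p j => (C * A ^ (p.1 : ℕ)) p.2 j

/-- `[K₀, …, K_{r-1}] M C̄`. -/
def matF {n m l s : ℕ} (A : Matrix (Fin n) (Fin n) ℝ) (C : Matrix (Fin l) (Fin n) ℝ)
    (K : Fin (s + 1) → Matrix (Fin m) (Fin l) ℝ) (q : Fin s → ℕ) (h : ℝ) :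
    Matrix (Fin m) (Fin n) ℝ :=
  matK K * matM l q h * matCbar s A C

/-- `D = A + B [K₀, …, K_{r-1}] M C̄`. -/
def matD {n m l s : ℕ} (A : Matrix (Fin n) (Fin n) ℝ) (B : Matrix (Fin n) (Fin m) ℝ)
    (C : Matrix (Fin l) (Fin n) ℝ) (K : Fin (s + 1) → Matrix (Fin m) (Fin l) ℝ)
    (q : Fin s → ℕ) (h : ℝ) : Matrix (Fin n) (Fin n) ℝ :=
  A + B * matF A C K q h

/-- `H = ∑_{i=1}^{r-1} (qᵢ h) ^ r Kᵢᵀ Rᵢ Kᵢ`. -/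
def matH {m l s : ℕ} (K : Fin (s + 1) → Matrix (Fin m) (Fin l) ℝ) (q : Fin s → ℕ) (h : ℝ)
    (R : Fin s → Matrix (Fin m) (Fin m) ℝ) : Matrix (Fin l) (Fin l) ℝ :=
  ∑ i : Fin s, ((q i : ℝ) * h) ^ (s + 1) • ((K i.succ)ᵀ * R i * K i.succ)

/-- The index type of `Φ`: four block rows, of heights `n`, `r m`, `(r - 1) m` and `l`. -/
abbrev PhiIndex (n m l s : ℕ) : Type :=
  (Fin n ⊕ (Fin (s + 1) × Fin m)) ⊕ ((Fin s × Fin m) ⊕ Fin l)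

/-- `Φ₁₁ = P D + Dᵀ P + 2 α P + h² e^{2αh} ∑_{i=0}^{r-1} (Kᵢ C A)ᵀ Wᵢ (Kᵢ C A)`. -/
def phi11 {n m l s : ℕ} (A : Matrix (Fin n) (Fin n) ℝ) (B : Matrix (Fin n) (Fin m) ℝ)
    (C : Matrix (Fin l) (Fin n) ℝ) (K : Fin (s + 1) → Matrix (Fin m) (Fin l) ℝ)
    (q : Fin s → ℕ) (h α : ℝ) (P : Matrix (Fin n) (Fin n) ℝ)
    (W : Fin (s + 1) → Matrix (Fin m) (Fin m) ℝ) : Matrix (Fin n) (Fin n) ℝ :=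
  P * matD A B C K q h + (matD A B C K q h)ᵀ * P + (2 * α) • P +
    (h ^ 2 * Real.exp (2 * α * h)) •
      ∑ i : Fin (s + 1), (K i * C * A)ᵀ * W i * (K i * C * A)

/-- `Φ₂₂ = -(π²/4) diag {W₀, e^{-2αq₁h} W₁, …, e^{-2αq_{r-1}h} W_{r-1}}`. -/
def phi22 {m s : ℕ} (q : Fin s → ℕ) (h α : ℝ) (W : Fin (s + 1) → Matrix (Fin m) (Fin m) ℝ) :
    Matrix (Fin (s + 1) × Fin m) (Fin (s + 1) × Fin m) ℝ :=
  -((Real.pi ^ 2 / 4) •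
    blockDiag fun i : Fin (s + 1) => Real.exp (-2 * α * (delay q i * h)) • W i)

/-- `Φ₃₃ = -(r!)² diag {e^{-2αqᵢh} / (qᵢh)^r Rᵢ}_{i=1,…,r-1}`. -/
def phi33 {m s : ℕ} (q : Fin s → ℕ) (h α : ℝ) (R : Fin s → Matrix (Fin m) (Fin m) ℝ) :
    Matrix (Fin s × Fin m) (Fin s × Fin m) ℝ :=
  -(((s + 1).factorial : ℝ) ^ 2 •
    blockDiag fun i : Fin s =>
      (Real.exp (-2 * α * (q i * h)) / ((q i : ℝ) * h) ^ (s + 1)) • R i)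

/-- The symmetric matrix `Φ = (Φ_{ij})`, `i, j = 1, …, 4`, where `Φ₁₂ = 1_rᵀ ⊗ P B`,
`Φ₁₃ = 1_{r-1}ᵀ ⊗ P B`, `Φ₁₄ = (C A^{r-1} D)ᵀ H`, `Φ₂₃ = 0`, `Φ₂₄ = 1_r ⊗ (C A^{r-1} B)ᵀ H`,
`Φ₃₄ = 1_{r-1} ⊗ (C A^{r-1} B)ᵀ H`, `Φ₄₄ = -H`. -/
def phi {n m l s : ℕ} (A : Matrix (Fin n) (Fin n) ℝ) (B : Matrix (Fin n) (Fin m) ℝ)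
    (C : Matrix (Fin l) (Fin n) ℝ) (K : Fin (s + 1) → Matrix (Fin m) (Fin l) ℝ)
    (q : Fin s → ℕ) (h α : ℝ) (P : Matrix (Fin n) (Fin n) ℝ)
    (W : Fin (s + 1) → Matrix (Fin m) (Fin m) ℝ) (R : Fin s → Matrix (Fin m) (Fin m) ℝ) :
    Matrix (PhiIndex n m l s) (PhiIndex n m l s) ℝ :=
  let H := matH K q h R
  let phi12 := repRow (Fin (s + 1)) (P * B)
  let phi13 := repRow (Fin s) (P * B)
  let phi14 := (C * A ^ s * matD A B C K q h)ᵀ * H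
  let phi24 := repCol (Fin (s + 1)) ((C * A ^ s * B)ᵀ * H)
  let phi34 := repCol (Fin s) ((C * A ^ s * B)ᵀ * H)
  let upperRight := Matrix.fromBlocks phi13 phi14 0 phi24
  Matrix.fromBlocks
    (Matrix.fromBlocks (phi11 A B C K q h α P W) phi12 phi12ᵀ (phi22 q h α W))
    upperRight upperRightᵀ
    (Matrix.fromBlocks (phi33 q h α R) phi34 phi34ᵀ (-H))

/-- The symmetric matrix `Φ_e`: `Φ` bordered by the two block columns
`[P B; 0; 0; H C A^{r-1} B]` and `[σ ([K₀, …, K_{r-1}] M C̄)ᵀ Ω; σ 1_r ⊗ Ω; σ 1_{r-1} ⊗ Ω; 0]`,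
with the lower right corner `diag {-Ω, -σ Ω}`. -/
def phiE {n m l s : ℕ} (A : Matrix (Fin n) (Fin n) ℝ) (B : Matrix (Fin n) (Fin m) ℝ)
    (C : Matrix (Fin l) (Fin n) ℝ) (K : Fin (s + 1) → Matrix (Fin m) (Fin l) ℝ)
    (q : Fin s → ℕ) (h α σ : ℝ) (P : Matrix (Fin n) (Fin n) ℝ)
    (Ω : Matrix (Fin m) (Fin m) ℝ)
    (W : Fin (s + 1) → Matrix (Fin m) (Fin m) ℝ) (R : Fin s → Matrix (Fin m) (Fin m) ℝ) :
    Matrix (PhiIndex n m l s ⊕ (Fin m ⊕ Fin m)) (PhiIndex n m l s ⊕ (Fin m ⊕ Fin m)) ℝ :=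
  let border : Matrix (PhiIndex n m l s) (Fin m ⊕ Fin m) ℝ :=
    Matrix.fromRows
      (Matrix.fromBlocks
        (P * B) (σ • ((matF A C K q h)ᵀ * Ω))
        0       (σ • repCol (Fin (s + 1)) Ω))
      (Matrix.fromBlocks
        0                                (σ • repCol (Fin s) Ω)
        (matH K q h R * (C * A ^ s * B)) 0)
  Matrix.fromBlocks (phi A B C K q h α P W R) border borderᵀ
    (Matrix.fromBlocks (-Ω) 0 0 (-(σ • Ω)))

end EventTriggered

end

/-!
With `V = xᵀ P x`, the identity `u(t_k) = F x + ∑ᵢ δᵢ + ∑ᵢ κᵢ` splits the control into the state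
feedback `F x`, the sampling errors `δᵢ` and the errors `κᵢ` of the Taylor polynomials of order
`r - 1` that stand for the delayed outputs. The LMI, evaluated at `(x, δ, κ, C A^{r-1} ẋ)` and at
the triggering error, bounds `V' + 2 α V` by the quadratic cost of `δ` and `κ` minus a quadratic
form in `C A x` and `C A^{r-1} ẋ`, which, thanks to the relative degree, are the derivatives `y'`
and `y^(r)` of the output. Integrated against the weight `e^{2αt}`, the cost of `δ` is at most the
part of that form in `y'`, by Wirtinger's inequality on each sampling interval, and the cost of `κ`
is at most the part in `y^(r)`, by the integral form of the Taylor remainder and the Cauchy-Schwarz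
inequality. The delays reach back before time `0` only during a bounded initial period, on which
the closed loop grows by at most a constant factor.
-/

namespace EventTriggered

open MeasureTheory Set Filter
open scoped Topology

section QuadraticForms

variable {ι a b : Type} [Fintype a] [Fintype b]

/-- The quadratic form `zᵀ X z` of a square matrix `X`. -/
def quadForm (X : Matrix a a ℝ) (z : a → ℝ) : ℝ := z ⬝ᵥ (X *ᵥ z)

theorem quadForm_neg (X : Matrix a a ℝ) (z : a → ℝ) : quadForm (-X) z = -quadForm X z := by
  simp only [quadForm, Matrix.neg_mulVec, dotProduct_neg]

theorem quadForm_smul (c : ℝ) (X : Matrix a a ℝ) (z : a → ℝ) :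
    quadForm (c • X) z = c * quadForm X z := by
  simp only [quadForm, Matrix.smul_mulVec, dotProduct_smul, smul_eq_mul]

theorem quadForm_sum [Fintype ι] (X : ι → Matrix a a ℝ) (z : a → ℝ) :
    quadForm (∑ i, X i) z = ∑ i, quadForm (X i) z := by
  simp only [quadForm, Matrix.sum_mulVec, dotProduct_sum]

theorem quadForm_transpose_mul_mul (X : Matrix b b ℝ) (Y : Matrix b a ℝ) (z : a → ℝ) :
    quadForm (Yᵀ * X * Y) z = quadForm X (Y *ᵥ z) := by
  rw [quadForm, quadForm, ← Matrix.mulVec_mulVec, ← Matrix.mulVec_mulVec,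
    Matrix.dotProduct_transpose_mulVec, dotProduct_comm]

theorem quadForm_smul_vec (X : Matrix a a ℝ) (r : ℝ) (z : a → ℝ) :
    quadForm X (r • z) = r ^ 2 * quadForm X z := by
  simp only [quadForm, Matrix.mulVec_smul, dotProduct_smul, smul_dotProduct, smul_eq_mul]
  ring

@[fun_prop]
theorem continuous_quadForm (X : Matrix a a ℝ) : Continuous (quadForm X) :=
  Continuous.dotProduct continuous_id (Continuous.matrix_mulVec continuous_const continuous_id)

theorem quadForm_nonneg {X : Matrix a a ℝ} (hX : X.PosSemidef) (z : a → ℝ) : 0 ≤ quadForm X z :=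
  hX.dotProduct_mulVec_nonneg z

theorem dotProduct_mulVec_comm {X : Matrix a a ℝ} (hX : X.IsHermitian) (v w : a → ℝ) :
    v ⬝ᵥ (X *ᵥ w) = w ⬝ᵥ (X *ᵥ v) := by
  nth_rw 1 [← hX.eq]
  exact Matrix.dotProduct_transpose_mulVec X v w

theorem quadForm_fromBlocks (X : Matrix a a ℝ) (Y : Matrix a b ℝ) (Z : Matrix b b ℝ)
    (v : a → ℝ) (w : b → ℝ) :
    quadForm (Matrix.fromBlocks X Y Yᵀ Z) (Sum.elim v w) =
      quadForm X v + 2 * (v ⬝ᵥ (Y *ᵥ w)) + quadForm Z w := by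
  simp only [quadForm, Matrix.fromBlocks_mulVec, Sum.elim_comp_inl, Sum.elim_comp_inr,
    sumElim_dotProduct_sumElim, dotProduct_add, Matrix.dotProduct_transpose_mulVec]
  ring

theorem repRow_mulVec_uncurry {c : Type} [Fintype ι] (X : Matrix c a ℝ) (w : ι → a → ℝ) :
    repRow ι X *ᵥ Function.uncurry w = X *ᵥ ∑ i, w i := by
  ext i
  simp only [repRow, Matrix.mulVec, dotProduct, Matrix.of_apply, Fintype.sum_prod_type,
    Finset.sum_apply, Finset.mul_sum, Function.uncurry_apply_pair]
  exact Finset.sum_comm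

theorem uncurry_dotProduct_repCol_mulVec [Fintype ι] (X : Matrix a b ℝ) (w : ι → a → ℝ)
    (v : b → ℝ) :
    Function.uncurry w ⬝ᵥ (repCol ι X *ᵥ v) = (∑ i, w i) ⬝ᵥ (X *ᵥ v) := by
  rw [sum_dotProduct]
  simp only [repCol, Matrix.mulVec, dotProduct, Matrix.of_apply, Fintype.sum_prod_type,
    Function.uncurry_apply_pair]

theorem quadForm_blockDiag [Fintype ι] [DecidableEq ι] (X : ι → Matrix a a ℝ) (w : ι → a → ℝ) :
    quadForm (blockDiag X) (Function.uncurry w) = ∑ i, quadForm (X i) (w i) := by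
  simp [quadForm, blockDiag, Matrix.mulVec, dotProduct, Fintype.sum_prod_type, ite_mul,
    Finset.sum_ite_irrel]

end QuadraticForms

section LMI

variable {n m l s : ℕ} {A : Matrix (Fin n) (Fin n) ℝ} {B : Matrix (Fin n) (Fin m) ℝ}
  {C : Matrix (Fin l) (Fin n) ℝ} {K : Fin (s + 1) → Matrix (Fin m) (Fin l) ℝ} {q : Fin s → ℕ}
  {h α σ : ℝ} {P : Matrix (Fin n) (Fin n) ℝ} {Ω : Matrix (Fin m) (Fin m) ℝ}
  {W : Fin (s + 1) → Matrix (Fin m) (Fin m) ℝ} {R : Fin s → Matrix (Fin m) (Fin m) ℝ}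

variable (q h α W R) in
/-- The negative terms of the LMI: the cost of the sampling errors `δ` and of the Taylor errors
`κ`, i.e. minus the quadratic forms of the blocks `Φ₂₂` and `Φ₃₃`. -/
noncomputable def errorCost (δ : Fin (s + 1) → Fin m → ℝ) (κ : Fin s → Fin m → ℝ) : ℝ :=
  Real.pi ^ 2 / 4 * ∑ i, Real.exp (-2 * α * (delay q i * h)) * quadForm (W i) (δ i) +
    ((s + 1).factorial : ℝ) ^ 2 * ∑ i : Fin s,
      Real.exp (-2 * α * (q i * h)) / ((q i : ℝ) * h) ^ (s + 1) * quadForm (R i) (κ i)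

variable (A C K q h α W R) in
/-- The terms of the LMI that pay for the errors, as a function of the state `x` and of its
velocity `v`. -/
noncomputable def errorBound (x v : Fin n → ℝ) : ℝ :=
  h ^ 2 * Real.exp (2 * α * h) * ∑ i, quadForm (W i) (K i *ᵥ (C *ᵥ (A *ᵥ x))) +
    ∑ i : Fin s, ((q i : ℝ) * h) ^ (s + 1) * quadForm (R i) (K i.succ *ᵥ ((C * A ^ s) *ᵥ v))

theorem matH_isHermitian (hR : ∀ i, (R i).IsHermitian) : (matH K q h R).IsHermitian := by
  have hR' (i : Fin s) : (R i)ᵀ = R i := (hR i).eq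
  simp [matH, Matrix.IsHermitian, Matrix.transpose_sum, Matrix.transpose_mul, Matrix.mul_assoc, hR']

theorem quadForm_matH (z : Fin l → ℝ) :
    quadForm (matH K q h R) z =
      ∑ i : Fin s, ((q i : ℝ) * h) ^ (s + 1) * quadForm (R i) (K i.succ *ᵥ z) := by
  simp only [matH, quadForm_sum, quadForm_smul, quadForm_transpose_mul_mul]

theorem quadForm_phi11 (hP : P.IsHermitian) (x : Fin n → ℝ) :
    quadForm (phi11 A B C K q h α P W) x =
      2 * (x ⬝ᵥ (P *ᵥ (matD A B C K q h *ᵥ x))) + 2 * α * quadForm P x +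
        h ^ 2 * Real.exp (2 * α * h) * ∑ i, quadForm (W i) (K i *ᵥ (C *ᵥ (A *ᵥ x))) := by
  have hPD : x ⬝ᵥ ((matD A B C K q h)ᵀ *ᵥ (P *ᵥ x)) =
      x ⬝ᵥ (P *ᵥ (matD A B C K q h *ᵥ x)) := by
    rw [Matrix.dotProduct_transpose_mulVec, dotProduct_comm,
      dotProduct_mulVec_comm hP]
  have hW (i : Fin (s + 1)) : quadForm (W i) (K i *ᵥ (C *ᵥ (A *ᵥ x))) =
      quadForm ((K i * C * A)ᵀ * W i * (K i * C * A)) x := by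
    rw [quadForm_transpose_mul_mul, Matrix.mulVec_mulVec, Matrix.mulVec_mulVec, Matrix.mul_assoc]
  simp only [hW, ← quadForm_sum]
  simp only [phi11, quadForm, Matrix.add_mulVec, dotProduct_add, Matrix.smul_mulVec,
    dotProduct_smul, smul_eq_mul, ← Matrix.mulVec_mulVec, hPD]
  ring

theorem quadForm_phi22_add_quadForm_phi33 (δ : Fin (s + 1) → Fin m → ℝ) (κ : Fin s → Fin m → ℝ) :
    quadForm (phi22 q h α W) (Function.uncurry δ) + quadForm (phi33 q h α R) (Function.uncurry κ) =
      -errorCost q h α W R δ κ := by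
  simp only [phi22, phi33, quadForm_neg, quadForm_smul, quadForm_blockDiag, errorCost]
  ring

theorem quadForm_phi (hP : P.IsHermitian) {x w : Fin n → ℝ} {δ : Fin (s + 1) → Fin m → ℝ}
    {κ : Fin s → Fin m → ℝ} (hw : w = matD A B C K q h *ᵥ x + B *ᵥ (∑ i, δ i + ∑ i, κ i))
    (η : Fin l → ℝ) :
    quadForm (phi A B C K q h α P W R)
        (Sum.elim (Sum.elim x (Function.uncurry δ)) (Sum.elim (Function.uncurry κ) η)) =
      2 * (x ⬝ᵥ (P *ᵥ w)) + 2 * α * quadForm P x +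
        h ^ 2 * Real.exp (2 * α * h) * ∑ i, quadForm (W i) (K i *ᵥ (C *ᵥ (A *ᵥ x))) +
        2 * (((C * A ^ s) *ᵥ w) ⬝ᵥ (matH K q h R *ᵥ η)) - quadForm (matH K q h R) η -
        errorCost q h α W R δ κ := by
  subst hw
  simp only [← neg_eq_iff_eq_neg.2 (quadForm_phi22_add_quadForm_phi33 (q := q) (W := W) δ κ)]
  simp only [phi, quadForm_fromBlocks, quadForm_phi11 hP, quadForm_neg, Matrix.fromBlocks_mulVec,
    Sum.elim_comp_inl, Sum.elim_comp_inr, sumElim_dotProduct_sumElim, Matrix.zero_mulVec, zero_add,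
    repRow_mulVec_uncurry, uncurry_dotProduct_repCol_mulVec, dotProduct_add, add_dotProduct,
    ← Matrix.mulVec_mulVec, Matrix.dotProduct_transpose_mulVec, Matrix.mulVec_add]
  simp only [dotProduct_comm (matH K q h R *ᵥ η)]
  ring

theorem quadForm_phiE (hP : P.IsHermitian) (hR : ∀ i, (R i).IsHermitian)
    {x v : Fin n → ℝ} {e u : Fin m → ℝ} {δ : Fin (s + 1) → Fin m → ℝ} {κ : Fin s → Fin m → ℝ}
    (hu : u = matF A C K q h *ᵥ x + ∑ i, δ i + ∑ i, κ i) (hv : v = A *ᵥ x + B *ᵥ (u + e)) :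
    quadForm (phiE A B C K q h α σ P Ω W R)
        (Sum.elim (Sum.elim (Sum.elim x (Function.uncurry δ))
          (Sum.elim (Function.uncurry κ) ((C * A ^ s) *ᵥ v))) (Sum.elim e u)) =
      2 * (x ⬝ᵥ (P *ᵥ v)) + 2 * α * quadForm P x + errorBound A C K q h α W R x v +
        σ * quadForm Ω u - quadForm Ω e - errorCost q h α W R δ κ := by
  set w := matD A B C K q h *ᵥ x + B *ᵥ (∑ i, δ i + ∑ i, κ i) with hw
  have hvw : v = w + B *ᵥ e := by
    rw [hv, hu, hw, matD]
    simp only [Matrix.mulVec_add, Matrix.add_mulVec, Matrix.mulVec_mulVec]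
    abel
  set η := (C * A ^ s) *ᵥ v with hη
  have hηe : η ⬝ᵥ (matH K q h R *ᵥ ((C * A ^ s) *ᵥ (B *ᵥ e))) +
      ((C * A ^ s) *ᵥ w) ⬝ᵥ (matH K q h R *ᵥ η) = quadForm (matH K q h R) η := by
    rw [dotProduct_mulVec_comm (matH_isHermitian hR), ← add_dotProduct, ← Matrix.mulVec_add,
      add_comm, ← hvw, quadForm]
  have hxv : x ⬝ᵥ (P *ᵥ v) = x ⬝ᵥ (P *ᵥ w) + x ⬝ᵥ (P *ᵥ (B *ᵥ e)) := by
    rw [hvw, Matrix.mulVec_add, dotProduct_add]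
  have hΩu : quadForm Ω u = (matF A C K q h *ᵥ x) ⬝ᵥ (Ω *ᵥ u) + (∑ i, δ i) ⬝ᵥ (Ω *ᵥ u) +
      (∑ i, κ i) ⬝ᵥ (Ω *ᵥ u) := by
    rw [← add_dotProduct, ← add_dotProduct, ← hu, quadForm]
  have hcorner : quadForm (Matrix.fromBlocks (-Ω) 0 0 (-(σ • Ω))) (Sum.elim e u) =
      -quadForm Ω e - σ * quadForm Ω u := by
    have := quadForm_fromBlocks (-Ω) 0 (-(σ • Ω)) e u
    simp only [Matrix.transpose_zero, Matrix.zero_mulVec, dotProduct_zero, quadForm_neg,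
      quadForm_smul] at this
    rw [this]
    ring
  rw [phiE, quadForm_fromBlocks, hcorner, quadForm_phi hP hw, errorBound, ← hη, ← quadForm_matH]
  simp only [Matrix.fromRows_mulVec, Matrix.fromBlocks_mulVec, Sum.elim_comp_inl,
    Sum.elim_comp_inr, sumElim_dotProduct_sumElim, Matrix.zero_mulVec, zero_add, add_zero,
    uncurry_dotProduct_repCol_mulVec, Matrix.smul_mulVec, dotProduct_add, dotProduct_smul,
    smul_eq_mul, ← Matrix.mulVec_mulVec, Matrix.dotProduct_transpose_mulVec]
  simp only [Matrix.mulVec_mulVec, Matrix.mul_assoc] at hηe hxv ⊢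
  rw [dotProduct_comm (Ω *ᵥ u)]
  linear_combination 2 * hηe - 2 * hxv - 2 * σ * hΩu

theorem lyapunov_rate_le (hP : P.IsHermitian) (hR : ∀ i, (R i).IsHermitian)
    (hLMI : (-phiE A B C K q h α σ P Ω W R).PosSemidef)
    {x v : Fin n → ℝ} {e u : Fin m → ℝ} {δ : Fin (s + 1) → Fin m → ℝ} {κ : Fin s → Fin m → ℝ}
    (hu : u = matF A C K q h *ᵥ x + ∑ i, δ i + ∑ i, κ i) (hv : v = A *ᵥ x + B *ᵥ (u + e)) :
    2 * (x ⬝ᵥ (P *ᵥ v)) + 2 * α * quadForm P x + errorBound A C K q h α W R x v +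
      σ * quadForm Ω u - quadForm Ω e ≤ errorCost q h α W R δ κ := by
  have := quadForm_nonneg hLMI (Sum.elim (Sum.elim (Sum.elim x (Function.uncurry δ))
    (Sum.elim (Function.uncurry κ) ((C * A ^ s) *ᵥ v))) (Sum.elim e u))
  rw [quadForm_neg, quadForm_phiE hP hR hu hv] at this
  linarith

theorem posSemidef_of_smul {a : Type} {X : Matrix a a ℝ} {c : ℝ} (hc : 0 < c)
    (hX : (c • X).PosSemidef) : X.PosSemidef := by
  simpa [smul_smul, hc.ne'] using hX.smul (inv_nonneg.2 hc.le)

theorem posSemidef_smul_trigger_of_lmi (hLMI : (-phiE A B C K q h α σ P Ω W R).PosSemidef) :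
    (σ • Ω).PosSemidef := by
  convert hLMI.submatrix (fun a : Fin m => Sum.inr (Sum.inr a))
  ext a b
  simp [phiE]

theorem posSemidef_samplingWeight_of_lmi (hLMI : (-phiE A B C K q h α σ P Ω W R).PosSemidef)
    (i : Fin (s + 1)) : (W i).PosSemidef := by
  refine posSemidef_of_smul
    (by positivity : 0 < Real.pi ^ 2 / 4 * Real.exp (-2 * α * (delay q i * h))) ?_
  convert hLMI.submatrix (fun a : Fin m => Sum.inl (Sum.inl (Sum.inr (i, a))))
  ext a b
  simp [phiE, phi, phi22, blockDiag, mul_assoc]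

theorem posSemidef_taylorWeight_of_lmi (hh : 0 < h) (hq : ∀ i, 0 < q i)
    (hLMI : (-phiE A B C K q h α σ P Ω W R).PosSemidef) (i : Fin s) : (R i).PosSemidef := by
  have := hq i
  refine posSemidef_of_smul (by positivity : 0 < ((s + 1).factorial : ℝ) ^ 2 *
    (Real.exp (-2 * α * (q i * h)) / ((q i : ℝ) * h) ^ (s + 1))) ?_
  convert hLMI.submatrix (fun a : Fin m => Sum.inl (Sum.inr (Sum.inl (i, a))))
  ext a b
  simp [phiE, phi, phi33, blockDiag, mul_assoc]

end LMI

section Comparison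

theorem exists_quadForm_eq_norm_sq {m : ℕ} {X : Matrix (Fin m) (Fin m) ℝ} (hX : X.PosSemidef) :
    ∃ L : (Fin m → ℝ) →L[ℝ] EuclideanSpace ℝ (Fin m), ∀ z, quadForm X z = ‖L z‖ ^ 2 := by
  open scoped MatrixOrder in
  obtain ⟨Y, rfl⟩ := CStarAlgebra.nonneg_iff_eq_star_mul_self.1 (Matrix.nonneg_iff_posSemidef.2 hX)
  refine ⟨(EuclideanSpace.equiv (Fin m) ℝ).symm.toContinuousLinearMap ∘L
    (Matrix.mulVecLin Y).toContinuousLinearMap, fun z => ?_⟩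
  calc quadForm (Yᵀ * Y) z = (Y *ᵥ z) ⬝ᵥ (Y *ᵥ z) := by
        rw [quadForm, ← Matrix.mulVec_mulVec, Matrix.dotProduct_transpose_mulVec]
    _ = ‖WithLp.toLp 2 (Y *ᵥ z)‖ ^ 2 := by
        rw [EuclideanSpace.real_norm_sq_eq]
        simp only [dotProduct, sq]

theorem exists_le_const_mul_of_homogeneous {E : Type*} [NormedAddCommGroup E] [NormedSpace ℝ E]
    [ProperSpace E] {f g : E → ℝ} (hf : Continuous f) (hg : Continuous g)
    (hf2 : ∀ (r : ℝ) z, f (r • z) = r ^ 2 * f z) (hg2 : ∀ (r : ℝ) z, g (r • z) = r ^ 2 * g z)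
    (hpos : ∀ z ≠ 0, 0 < g z) : ∃ c > 0, ∀ z, f z ≤ c * g z := by
  have hsphere : ∀ z ∈ Metric.sphere (0 : E) 1, 0 < g z := fun z hz =>
    hpos z (Metric.ne_of_mem_sphere hz one_ne_zero)
  obtain ⟨c, hc⟩ := (isCompact_sphere (0 : E) 1).exists_bound_of_continuousOn
    (hf.continuousOn.div hg.continuousOn fun z hz => (hsphere z hz).ne')
  refine ⟨max c 1, by positivity, fun z => ?_⟩
  rcases eq_or_ne z 0 with rfl | hz
  · have hf0 : f 0 = 0 := by simpa using hf2 0 0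
    have hg0 : g 0 = 0 := by simpa using hg2 0 0
    rw [hf0, hg0, mul_zero]
  obtain ⟨w, hw, hzw⟩ : ∃ w ∈ Metric.sphere (0 : E) 1, z = ‖z‖ • w :=
    ⟨‖z‖⁻¹ • z, by simp [norm_smul, hz], by simp [smul_smul, hz]⟩
  have hfw : f w ≤ max c 1 * g w :=
    (div_le_iff₀ (hsphere w hw)).1 ((le_abs_self _).trans ((hc w hw).trans (le_max_left c 1)))
  rw [hzw, hf2, hg2]
  calc ‖z‖ ^ 2 * f w ≤ ‖z‖ ^ 2 * (max c 1 * g w) := by gcongr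
    _ = max c 1 * (‖z‖ ^ 2 * g w) := by ring

end Comparison

section LocPrecompact

variable {E F : Type*} [TopologicalSpace E] [TopologicalSpace F]

/-- Strongly measurable signals that map compact intervals into compact sets. The class contains
the continuous and the sample-and-hold signals, is stable under continuous operations and time
shifts, and consists of locally integrable functions. -/
def LocPrecompact (f : ℝ → E) : Prop :=
  StronglyMeasurable f ∧ ∀ a b, ∃ S, IsCompact S ∧ MapsTo f (Icc a b) S

namespace LocPrecompact

theorem of_continuous [TopologicalSpace.PseudoMetrizableSpace E] {f : ℝ → E}
    (hf : Continuous f) : LocPrecompact f :=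
  ⟨hf.stronglyMeasurable, fun _ _ => ⟨_, isCompact_Icc.image hf, mapsTo_image _ _⟩⟩

theorem continuous_comp {f : ℝ → E} (hf : LocPrecompact f) {g : E → F} (hg : Continuous g) :
    LocPrecompact fun t => g (f t) := by
  refine ⟨hg.comp_stronglyMeasurable hf.1, fun a b => ?_⟩
  obtain ⟨S, hS, hfS⟩ := hf.2 a b
  exact ⟨g '' S, hS.image hg, fun t ht => mem_image_of_mem g (hfS ht)⟩

theorem prodMk {f : ℝ → E} {g : ℝ → F} (hf : LocPrecompact f) (hg : LocPrecompact g) :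
    LocPrecompact fun t => (f t, g t) := by
  refine ⟨hf.1.prodMk hg.1, fun a b => ?_⟩
  obtain ⟨S, hS, hfS⟩ := hf.2 a b
  obtain ⟨T, hT, hgT⟩ := hg.2 a b
  exact ⟨S ×ˢ T, hS.prod hT, fun t ht => ⟨hfS ht, hgT ht⟩⟩

theorem pi {ι : Type*} [Countable ι] [TopologicalSpace.PseudoMetrizableSpace E]
    [SecondCountableTopology E] {f : ι → ℝ → E} (hf : ∀ i, LocPrecompact (f i)) :
    LocPrecompact fun t i => f i t := by
  borelize E
  refine ⟨(measurable_pi_lambda _ fun i => (hf i).1.measurable).stronglyMeasurable, fun a b => ?_⟩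
  choose S hS hfS using fun i => (hf i).2 a b
  exact ⟨univ.pi S, isCompact_univ_pi hS, fun t ht i _ => hfS i ht⟩

theorem continuous_mul {w f : ℝ → ℝ} (hw : Continuous w) (hf : LocPrecompact f) :
    LocPrecompact fun t => w t * f t :=
  ((of_continuous hw).prodMk hf).continuous_comp _root_.continuous_mul

theorem comp_add_const {f : ℝ → E} (hf : LocPrecompact f) (c : ℝ) :
    LocPrecompact fun t => f (t + c) := by
  refine ⟨hf.1.comp_measurable (measurable_id.add_const c), fun a b => ?_⟩
  obtain ⟨S, hS, hfS⟩ := hf.2 (a + c) (b + c)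
  exact ⟨S, hS, fun t ht => hfS ⟨by linarith [ht.1], by linarith [ht.2]⟩⟩

theorem sampleHold (u : ℕ → E) (h : ℝ) : LocPrecompact fun t => u ⌊t / h⌋₊ := by
  refine ⟨(StronglyMeasurable.of_discrete (f := u)).comp_measurable (by fun_prop), fun a b => ?_⟩
  refine ⟨u '' Iic (max ⌊a / h⌋₊ ⌊b / h⌋₊), ((finite_Iic _).image u).isCompact, fun t ht => ?_⟩
  refine mem_image_of_mem u (mem_Iic.2 (le_max_iff.2 ?_))
  rcases le_total 0 h with hh | hh
  · exact Or.inr (Nat.floor_mono (by gcongr; exact ht.2))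
  · exact Or.inl (Nat.floor_mono (div_le_div_of_nonpos_of_le hh ht.1))

theorem intervalIntegrable {E : Type*} [NormedAddCommGroup E] {f : ℝ → E} (hf : LocPrecompact f)
    (a b : ℝ) : IntervalIntegrable f volume a b := by
  obtain ⟨S, hS, hfS⟩ := hf.2 (min a b) (max a b)
  obtain ⟨M, hM⟩ := hS.isBounded.exists_norm_le
  refine intervalIntegrable_iff.2 (Measure.integrableOn_of_bounded (M := M) (by simp)
    hf.1.aestronglyMeasurable ?_)
  exact (ae_restrict_iff' measurableSet_uIoc).2 (ae_of_all _ fun t ht =>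
    hM _ (hfS (uIoc_subset_uIcc ht)))

end LocPrecompact

end LocPrecompact

section Wirtinger

variable {E : Type*} [NormedAddCommGroup E] [InnerProductSpace ℝ E] {f f' : ℝ → E} {a b h α : ℝ}

theorem const_mul_integral_norm_sq_le_of_riccati {p : ℝ → ℝ} {c : ℝ} (hab : a ≤ b)
    (hf : ContinuousOn f (Icc a b)) (hf' : ∀ t ∈ Ioo a b, HasDerivWithinAt f (f' t) (Ioi t) t)
    (hint : IntervalIntegrable (fun t => ‖f' t‖ ^ 2) volume a b) (hfa : f a = 0)
    (hp : ∀ t ∈ Icc a b, HasDerivAt p (-(c + p t ^ 2)) t) (hpb : 0 ≤ p b) :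
    c * ∫ t in a..b, ‖f t‖ ^ 2 ≤ ∫ t in a..b, ‖f' t‖ ^ 2 := by
  have hfi : IntervalIntegrable (fun t => ‖f t‖ ^ 2) volume a b :=
    (hf.norm.pow 2).intervalIntegrable_of_Icc hab
  have key : p b * ‖f b‖ ^ 2 - p a * ‖f a‖ ^ 2 ≤ ∫ t in a..b, (‖f' t‖ ^ 2 - c * ‖f t‖ ^ 2) := by
    refine intervalIntegral.sub_le_integral_of_hasDeriv_right_of_le hab
      (ContinuousOn.mul (fun t ht => (hp t ht).continuousAt.continuousWithinAt) (hf.norm.pow 2))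
      (fun t ht => (hp t (Ioo_subset_Icc_self ht)).hasDerivWithinAt.mul (hf' t ht).norm_sq)
      ((intervalIntegrable_iff_integrableOn_Icc_of_le hab).1 (hint.sub (hfi.const_mul c)))
      fun t _ => ?_
    have hsq : 0 ≤ ‖f' t - p t • f t‖ ^ 2 := by positivity
    rw [norm_sub_sq_real, inner_smul_right, norm_smul, mul_pow, Real.norm_eq_abs, sq_abs,
      real_inner_comm] at hsq
    simp only [Pi.pow_apply]
    linarith
  rw [intervalIntegral.integral_sub hint (hfi.const_mul c), intervalIntegral.integral_const_mul,
    hfa, norm_zero] at key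
  have : 0 ≤ p b * ‖f b‖ ^ 2 := by positivity
  linarith

theorem sq_mul_integral_norm_sq_le {ω : ℝ} (hab : a ≤ b) (hf : ContinuousOn f (Icc a b))
    (hf' : ∀ t ∈ Ioo a b, HasDerivWithinAt f (f' t) (Ioi t) t)
    (hint : IntervalIntegrable (fun t => ‖f' t‖ ^ 2) volume a b) (hfa : f a = 0)
    (hω : 0 ≤ ω) (hωπ : ω * (b - a) < Real.pi / 2) :
    ω ^ 2 * ∫ t in a..b, ‖f t‖ ^ 2 ≤ ∫ t in a..b, ‖f' t‖ ^ 2 := by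
  refine const_mul_integral_norm_sq_le_of_riccati (p := fun t => ω * Real.tan (ω * (b - t)))
    hab hf hf' hint hfa (fun t ht => ?_) (by simp)
  have hcos : 0 < Real.cos (ω * (b - t)) := by
    refine Real.cos_pos_of_mem_Ioo ⟨?_, lt_of_le_of_lt ?_ hωπ⟩
    · have := mul_nonneg hω (sub_nonneg.2 ht.2)
      linarith [Real.pi_pos]
    · gcongr
      exact ht.1
  have hlin : HasDerivAt (fun t => ω * (b - t)) (ω * -1) t :=
    ((hasDerivAt_id t).const_sub b).const_mul ω
  refine (((Real.hasDerivAt_tan hcos.ne').comp t hlin).const_mul ω).congr_deriv ?_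
  rw [mul_pow, Real.tan_eq_sin_div_cos]
  field_simp
  linear_combination ω ^ 2 * Real.sin_sq_add_cos_sq (ω * (b - t))

theorem wirtinger_inequality (hab : a ≤ b) (hf : ContinuousOn f (Icc a b))
    (hf' : ∀ t ∈ Ioo a b, HasDerivWithinAt f (f' t) (Ioi t) t)
    (hint : IntervalIntegrable (fun t => ‖f' t‖ ^ 2) volume a b) (hfa : f a = 0) :
    Real.pi ^ 2 / 4 * ∫ t in a..b, ‖f t‖ ^ 2 ≤ (b - a) ^ 2 * ∫ t in a..b, ‖f' t‖ ^ 2 := by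
  rcases hab.eq_or_lt with rfl | hlt
  · simp
  have hlim : Tendsto (fun θ : ℝ => θ ^ 2 * ∫ t in a..b, ‖f t‖ ^ 2) (𝓝[<] (Real.pi / 2))
      (𝓝 ((Real.pi / 2) ^ 2 * ∫ t in a..b, ‖f t‖ ^ 2)) :=
    Tendsto.mono_left (Continuous.tendsto (by fun_prop) _) nhdsWithin_le_nhds
  have hθ : ∀ θ ∈ Ioo 0 (Real.pi / 2),
      θ ^ 2 * ∫ t in a..b, ‖f t‖ ^ 2 ≤ (b - a) ^ 2 * ∫ t in a..b, ‖f' t‖ ^ 2 := by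
    rintro θ ⟨hθ0, hθπ⟩
    have hlen : 0 < b - a := sub_pos.2 hlt
    have hω := sq_mul_integral_norm_sq_le hab hf hf' hint hfa (ω := θ / (b - a)) (by positivity)
      (by rwa [div_mul_cancel₀ _ hlen.ne'])
    rwa [div_pow, div_mul_eq_mul_div, div_le_iff₀' (by positivity)] at hω
  have := le_of_tendsto hlim (mem_of_superset (Ioo_mem_nhdsLT (by positivity)) hθ)
  rwa [div_pow, show (2 : ℝ) ^ 2 = 4 by norm_num] at this

theorem wirtinger_inequality_exp (hα : 0 ≤ α) (hab : a ≤ b) (hbh : b - a ≤ h)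
    (hf : ContinuousOn f (Icc a b)) (hf' : ∀ t ∈ Ioo a b, HasDerivWithinAt f (f' t) (Ioi t) t)
    (hint : IntervalIntegrable (fun t => ‖f' t‖ ^ 2) volume a b) (hfa : f a = 0) :
    Real.pi ^ 2 / 4 * ∫ t in a..b, Real.exp (2 * α * t) * ‖f t‖ ^ 2 ≤
      h ^ 2 * Real.exp (2 * α * h) * ∫ t in a..b, Real.exp (2 * α * t) * ‖f' t‖ ^ 2 := by
  have hfi : IntervalIntegrable (fun t => ‖f t‖ ^ 2) volume a b :=
    (hf.norm.pow 2).intervalIntegrable_of_Icc hab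
  have hexp : ContinuousOn (fun t => Real.exp (2 * α * t)) (uIcc a b) := by fun_prop
  have : 0 ≤ b - a := sub_nonneg.2 hab
  have hI' : 0 ≤ ∫ t in a..b, Real.exp (2 * α * t) * ‖f' t‖ ^ 2 :=
    intervalIntegral.integral_nonneg hab fun t _ => by positivity
  have hup : ∫ t in a..b, Real.exp (2 * α * t) * ‖f t‖ ^ 2 ≤
      Real.exp (2 * α * b) * ∫ t in a..b, ‖f t‖ ^ 2 := by
    rw [← intervalIntegral.integral_const_mul]
    refine intervalIntegral.integral_mono_on hab (hfi.continuousOn_mul hexp)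
      (hfi.const_mul _) fun t ht => ?_
    gcongr
    exact ht.2
  have hdown : Real.exp (2 * α * a) * ∫ t in a..b, ‖f' t‖ ^ 2 ≤
      ∫ t in a..b, Real.exp (2 * α * t) * ‖f' t‖ ^ 2 := by
    rw [← intervalIntegral.integral_const_mul]
    refine intervalIntegral.integral_mono_on hab (hint.const_mul _)
      (hint.continuousOn_mul hexp) fun t ht => ?_
    gcongr
    exact ht.1
  calc Real.pi ^ 2 / 4 * ∫ t in a..b, Real.exp (2 * α * t) * ‖f t‖ ^ 2
      ≤ Real.exp (2 * α * b) * (Real.pi ^ 2 / 4 * ∫ t in a..b, ‖f t‖ ^ 2) := by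
        rw [mul_left_comm]
        gcongr
    _ ≤ Real.exp (2 * α * b) * ((b - a) ^ 2 * ∫ t in a..b, ‖f' t‖ ^ 2) := by
        exact mul_le_mul_of_nonneg_left (wirtinger_inequality hab hf hf' hint hfa)
          (Real.exp_nonneg _)
    _ = (b - a) ^ 2 * Real.exp (2 * α * (b - a)) *
          (Real.exp (2 * α * a) * ∫ t in a..b, ‖f' t‖ ^ 2) := by
        rw [show 2 * α * b = 2 * α * (b - a) + 2 * α * a by ring, Real.exp_add]
        ring
    _ ≤ (b - a) ^ 2 * Real.exp (2 * α * (b - a)) *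
          ∫ t in a..b, Real.exp (2 * α * t) * ‖f' t‖ ^ 2 := by gcongr
    _ ≤ h ^ 2 * Real.exp (2 * α * h) * ∫ t in a..b, Real.exp (2 * α * t) * ‖f' t‖ ^ 2 := by
        gcongr

end Wirtinger

section Sampling

variable {h α : ℝ}

theorem integral_le_integral_of_steps {F G : ℝ → ℝ} (hh : 0 < h)
    (hF : ∀ a b, IntervalIntegrable F volume a b) (hG : ∀ a b, IntervalIntegrable G volume a b)
    (hstep : ∀ k : ℕ, ∀ b ∈ Icc (k * h) ((k + 1) * h), ∫ t in k * h..b, F t ≤ ∫ t in k * h..b, G t)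
    {T : ℝ} (hT : 0 ≤ T) : ∫ t in 0..T, F t ≤ ∫ t in 0..T, G t := by
  have hextend (k : ℕ) (hk : ∫ t in 0..k * h, F t ≤ ∫ t in 0..k * h, G t)
      {b : ℝ} (hb : b ∈ Icc (k * h) ((k + 1) * h)) : ∫ t in 0..b, F t ≤ ∫ t in 0..b, G t := by
    rw [← intervalIntegral.integral_add_adjacent_intervals (hF 0 (k * h)) (hF _ b),
      ← intervalIntegral.integral_add_adjacent_intervals (hG 0 (k * h)) (hG _ b)]
    exact add_le_add hk (hstep k b hb)
  have hgrid (k : ℕ) : ∫ t in 0..k * h, F t ≤ ∫ t in 0..k * h, G t := by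
    induction k with
    | zero => simp
    | succ k ih =>
      push_cast
      exact hextend k ih ⟨by nlinarith, le_rfl⟩
  exact hextend ⌊T / h⌋₊ (hgrid _) ⟨(le_div_iff₀ hh).1 (Nat.floor_le (by positivity)),
    (div_le_iff₀ hh).1 (Nat.lt_floor_add_one _).le⟩

theorem floor_div_eq_of_mem_Ico (hh : 0 < h) {k : ℕ} {t : ℝ}
    (ht : t ∈ Ico (k * h) ((k + 1) * h)) : ⌊t / h⌋₊ = k := by
  have hk : (k : ℝ) ≤ t / h := (le_div_iff₀ hh).2 ht.1
  exact (Nat.floor_eq_iff (k.cast_nonneg.trans hk)).2 ⟨hk, (div_lt_iff₀ hh).2 ht.2⟩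

theorem floor_sub_natCast_mul_div_mul (hh : 0 < h) {k : ℕ} {t : ℝ} (ht : k * h ≤ t) :
    (⌊(t - k * h) / h⌋₊ : ℝ) * h = ⌊t / h⌋₊ * h - k * h := by
  have hk : k ≤ ⌊t / h⌋₊ := Nat.le_floor ((le_div_iff₀ hh).2 ht)
  rw [sub_div, mul_div_cancel_right₀ _ hh.ne', Nat.floor_sub_natCast, Nat.cast_sub hk, sub_mul]

theorem locPrecompact_sq_norm_sample_sub {E : Type*} [NormedAddCommGroup E] {g : ℝ → E}
    (hg : Continuous g) (h : ℝ) : LocPrecompact fun t => ‖g (⌊t / h⌋₊ * h) - g t‖ ^ 2 :=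
  ((LocPrecompact.sampleHold (fun k => g (k * h)) h).prodMk
    (.of_continuous hg)).continuous_comp (g := fun z : E × E => ‖z.1 - z.2‖ ^ 2) (by fun_prop)

theorem sampling_inequality {E : Type*} [NormedAddCommGroup E] [InnerProductSpace ℝ E]
    {g g' : ℝ → E} (hα : 0 ≤ α) (hh : 0 < h) (hg : Continuous g) (hg'c : LocPrecompact g')
    (hg' : ∀ t, 0 ≤ t → HasDerivWithinAt g (g' t) (Ioi t) t) {T : ℝ} (hT : 0 ≤ T) :
    Real.pi ^ 2 / 4 * ∫ t in 0..T, Real.exp (2 * α * t) * ‖g (⌊t / h⌋₊ * h) - g t‖ ^ 2 ≤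
      h ^ 2 * Real.exp (2 * α * h) * ∫ t in 0..T, Real.exp (2 * α * t) * ‖g' t‖ ^ 2 := by
  have hexp : Continuous fun t => Real.exp (2 * α * t) := by fun_prop
  have hg'sq : LocPrecompact fun t => ‖g' t‖ ^ 2 :=
    hg'c.continuous_comp (g := fun z => ‖z‖ ^ 2) (by fun_prop)
  simp only [← intervalIntegral.integral_const_mul]
  refine integral_le_integral_of_steps hh
    (fun a b => (((locPrecompact_sq_norm_sample_sub hg h).continuous_mul
      hexp).intervalIntegrable a b).const_mul _)
    (fun a b => ((hg'sq.continuous_mul hexp).intervalIntegrable a b).const_mul _)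
    (fun k b hb => ?_) hT
  have hk : (0 : ℝ) ≤ k * h := by positivity
  have hheld : ∫ t in k * h..b, Real.exp (2 * α * t) * ‖g (⌊t / h⌋₊ * h) - g t‖ ^ 2 =
      ∫ t in k * h..b, Real.exp (2 * α * t) * ‖g t - g (k * h)‖ ^ 2 := by
    refine intervalIntegral.integral_congr_Ioo_of_le hb.1 fun t ht => ?_
    simp only [floor_div_eq_of_mem_Ico hh ⟨ht.1.le, ht.2.trans_le hb.2⟩, norm_sub_rev]
  rw [intervalIntegral.integral_const_mul, intervalIntegral.integral_const_mul, hheld]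
  exact wirtinger_inequality_exp hα hb.1 (by linarith [hb.2]) (by fun_prop)
    (fun t ht => (hg' t (hk.trans ht.1.le)).sub_const _) (hg'sq.intervalIntegrable _ _) (sub_self _)

theorem integral_exp_mul_comp_sub_le {G : ℝ → ℝ} (hG : LocPrecompact G) (hG0 : ∀ t, 0 ≤ G t)
    {d a T : ℝ} (hd : 0 ≤ d) (hda : d ≤ a) (haT : a ≤ T) :
    Real.exp (-2 * α * d) * ∫ t in a..T, Real.exp (2 * α * t) * G (t - d) ≤
      ∫ t in 0..T, Real.exp (2 * α * t) * G t := by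
  have hshift : Real.exp (-2 * α * d) * ∫ t in a..T, Real.exp (2 * α * t) * G (t - d) =
      ∫ t in a - d..T - d, Real.exp (2 * α * t) * G t := by
    rw [← intervalIntegral.integral_const_mul,
      ← intervalIntegral.integral_comp_sub_right (fun t => Real.exp (2 * α * t) * G t)]
    refine intervalIntegral.integral_congr fun t _ => ?_
    simp only [← mul_assoc, ← Real.exp_add]
    ring_nf
  rw [hshift]
  exact intervalIntegral.integral_mono_interval (by linarith) (by linarith) (by linarith)
    (ae_of_all _ fun t => mul_nonneg (Real.exp_nonneg _) (hG0 t))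
    ((hG.continuous_mul (by fun_prop)).intervalIntegrable _ _)

end Sampling

section Taylor

variable {E : Type*} [NormedAddCommGroup E] [NormedSpace ℝ E]

theorem sq_norm_integral_smul_le {w : ℝ → ℝ} {f : ℝ → E} {a b : ℝ} (hab : a ≤ b)
    (hw : Continuous w) (hw0 : ∀ t ∈ Icc a b, 0 ≤ w t) (hf : LocPrecompact f) :
    ‖∫ t in a..b, w t • f t‖ ^ 2 ≤ (∫ t in a..b, w t) * ∫ t in a..b, w t * ‖f t‖ ^ 2 := by
  have hi0 := hw.intervalIntegrable (μ := volume) a b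
  have hi1 := ((hf.continuous_comp continuous_norm).continuous_mul hw).intervalIntegrable a b
  have hi2 := ((hf.continuous_comp (g := fun z => ‖z‖ ^ 2) (by fun_prop)).continuous_mul
    hw).intervalIntegrable a b
  have hnorm : ‖∫ t in a..b, w t • f t‖ ≤ ∫ t in a..b, w t * ‖f t‖ := by
    refine (intervalIntegral.norm_integral_le_integral_norm hab).trans_eq
      (intervalIntegral.integral_congr fun t ht => ?_)
    rw [uIcc_of_le hab] at ht
    simp only [norm_smul, Real.norm_of_nonneg (hw0 t ht)]
  have hquad (x : ℝ) : 0 ≤ (∫ t in a..b, w t) * (x * x) +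
      -2 * (∫ t in a..b, w t * ‖f t‖) * x + ∫ t in a..b, w t * ‖f t‖ ^ 2 := by
    have hsq : 0 ≤ ∫ t in a..b, (w t * (x * x) - 2 * x * (w t * ‖f t‖) + w t * ‖f t‖ ^ 2) :=
      intervalIntegral.integral_nonneg hab fun t ht => by
        have := mul_nonneg (hw0 t ht) (sq_nonneg (x - ‖f t‖))
        linarith
    rw [intervalIntegral.integral_add ((hi0.mul_const _).sub (hi1.const_mul _)) hi2,
      intervalIntegral.integral_sub (hi0.mul_const _) (hi1.const_mul _),
      intervalIntegral.integral_mul_const, intervalIntegral.integral_const_mul] at hsq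
    linarith
  have hdisc := discrim_le_zero hquad
  rw [discrim] at hdisc
  calc ‖∫ t in a..b, w t • f t‖ ^ 2 ≤ (∫ t in a..b, w t * ‖f t‖) ^ 2 := by gcongr
    _ ≤ (∫ t in a..b, w t) * ∫ t in a..b, w t * ‖f t‖ ^ 2 := by linarith

theorem hasDerivWithinAt_taylorSum {φ : ℕ → ℝ → E} {s : ℕ} {c t : ℝ} {S : Set ℝ}
    (hφ : ∀ j ≤ s, HasDerivWithinAt (φ j) (φ (j + 1) t) S t) :
    HasDerivWithinAt
      (fun v => ∑ j ∈ Finset.range (s + 1), ((c - v) ^ j / (j.factorial : ℝ)) • φ j v)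
      (((c - t) ^ s / (s.factorial : ℝ)) • φ (s + 1) t) S t := by
  induction s with
  | zero => simpa using hφ 0 le_rfl
  | succ s ih =>
    simp only [Finset.sum_range_succ _ (s + 1)]
    have hpow : HasDerivWithinAt (fun v => (c - v) ^ (s + 1) / ((s + 1).factorial : ℝ))
        (-((c - t) ^ s / (s.factorial : ℝ))) S t := by
      refine HasDerivWithinAt.congr_deriv
        (((hasDerivWithinAt_id t S).const_sub c).fun_pow (s + 1) |>.div_const _) ?_
      rw [Nat.factorial_succ]
      push_cast
      field_simp
      simp
    refine ((ih fun j hj => hφ j (by omega)).add (hpow.smul (hφ (s + 1) le_rfl))).congr_deriv ?_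
    module

theorem taylorSum_sub_eq_integral [CompleteSpace E] {φ : ℕ → ℝ → E} {s : ℕ} {c t : ℝ} (hct : c ≤ t)
    (hφc : ∀ j ≤ s, ContinuousOn (φ j) (Icc c t))
    (hφ : ∀ j ≤ s, ∀ v ∈ Ioo c t, HasDerivWithinAt (φ j) (φ (j + 1) v) (Ioi v) v)
    (hint : IntervalIntegrable (φ (s + 1)) volume c t) :
    ∑ j ∈ Finset.range (s + 1), ((c - t) ^ j / (j.factorial : ℝ)) • φ j t - φ 0 c =
      ∫ v in c..t, ((c - v) ^ s / (s.factorial : ℝ)) • φ (s + 1) v := by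
  have hcont : ContinuousOn (fun v => ∑ j ∈ Finset.range (s + 1),
      ((c - v) ^ j / (j.factorial : ℝ)) • φ j v) (Icc c t) :=
    continuousOn_finsetSum _ fun j hj => ContinuousOn.smul (by fun_prop)
      (hφc j (Nat.lt_succ_iff.1 (Finset.mem_range.1 hj)))
  rw [intervalIntegral.integral_eq_sub_of_hasDeriv_right_of_le hct hcont
    (fun v hv => hasDerivWithinAt_taylorSum fun j hj => hφ j hj v hv)
    (hint.continuousOn_smul (by fun_prop))]
  simp [Finset.sum_range_succ']

theorem integral_pow_div_factorial (s : ℕ) (d : ℝ) :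
    ∫ v in 0..d, v ^ s / (s.factorial : ℝ) = d ^ (s + 1) / ((s + 1).factorial : ℝ) := by
  rw [intervalIntegral.integral_div, integral_pow, Nat.factorial_succ]
  push_cast
  field_simp
  simp

theorem sq_norm_taylorSum_sub_le [CompleteSpace E] {φ : ℕ → ℝ → E} {s : ℕ} {t d : ℝ} (hd : 0 ≤ d)
    (hφc : ∀ j ≤ s, ContinuousOn (φ j) (Icc (t - d) t))
    (hφ : ∀ j ≤ s, ∀ v ∈ Ioo (t - d) t, HasDerivWithinAt (φ j) (φ (j + 1) v) (Ioi v) v)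
    (hφs : LocPrecompact (φ (s + 1))) :
    ‖∑ j ∈ Finset.range (s + 1), ((-d) ^ j / (j.factorial : ℝ)) • φ j t - φ 0 (t - d)‖ ^ 2 ≤
      d ^ (s + 1) / ((s + 1).factorial : ℝ) *
        ∫ v in 0..d, v ^ s / (s.factorial : ℝ) * ‖φ (s + 1) (v + (t - d))‖ ^ 2 := by
  have hrem := taylorSum_sub_eq_integral (sub_le_self t hd) hφc hφ (hφs.intervalIntegrable _ _)
  have hshift := intervalIntegral.integral_comp_add_right (a := 0) (b := d)
    (fun v => ((t - d - v) ^ s / (s.factorial : ℝ)) • φ (s + 1) v) (t - d)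
  have hsign (v : ℝ) : ((t - d - (v + (t - d))) ^ s / (s.factorial : ℝ)) • φ (s + 1) (v + (t - d)) =
      (v ^ s / (s.factorial : ℝ)) • (-1 : ℝ) ^ s • φ (s + 1) (v + (t - d)) := by
    rw [show t - d - (v + (t - d)) = v * (-1) by ring, mul_pow, smul_smul]
    congr 1
    ring
  simp only [hsign, zero_add, add_sub_cancel] at hshift
  rw [show t - d - t = -d by ring, ← hshift] at hrem
  rw [hrem, ← integral_pow_div_factorial]
  have hψ : LocPrecompact fun v => (-1 : ℝ) ^ s • φ (s + 1) (v + (t - d)) :=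
    (hφs.comp_add_const (t - d)).continuous_comp (continuous_const_smul _)
  convert sq_norm_integral_smul_le (w := fun v => v ^ s / (s.factorial : ℝ)) hd
    (by fun_prop) (fun v hv => ?_) hψ using 5
  · simp [norm_smul]
  · have := hv.1
    positivity

theorem integrableOn_mul_comp_add {w G : ℝ → ℝ} (hw : Continuous w) (hG : LocPrecompact G)
    (a b c d e : ℝ) :
    IntegrableOn (Function.uncurry fun t v => w v * G (v + (t - e))) (uIoc a b ×ˢ uIoc c d) := by
  obtain ⟨S, hS, hwS⟩ := (LocPrecompact.of_continuous hw).2 (min c d) (max c d)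
  obtain ⟨S', hS', hGS⟩ := hG.2 (min c d + (min a b - e)) (max c d + (max a b - e))
  obtain ⟨M, hM⟩ := hS.isBounded.exists_norm_le
  obtain ⟨M', hM'⟩ := hS'.isBounded.exists_norm_le
  refine Measure.integrableOn_of_bounded (M := M * M') ?_ ?_ ?_
  · rw [Measure.volume_eq_prod, Measure.prod_prod]
    simp [uIoc, ENNReal.mul_eq_top]
  · exact ((hw.stronglyMeasurable.comp_measurable measurable_snd).mul
      (hG.1.comp_measurable (by fun_prop))).aestronglyMeasurable
  · refine (ae_restrict_iff' (measurableSet_uIoc.prod measurableSet_uIoc)).2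
      (ae_of_all _ fun p hp => ?_)
    have hpw := hM _ (hwS (Ioc_subset_Icc_self hp.2))
    have hpG := hM' (G (p.2 + (p.1 - e))) (hGS ⟨by gcongr; exacts [hp.2.1.le, hp.1.1.le],
      by gcongr; exacts [hp.2.2, hp.1.2]⟩)
    simp only [Function.uncurry, norm_mul]
    exact mul_le_mul hpw hpG (norm_nonneg _) ((norm_nonneg _).trans hpw)

theorem intervalIntegrable_integral_mul_comp_add {w G : ℝ → ℝ} (hw : Continuous w)
    (hG : LocPrecompact G) (a b c d e : ℝ) :
    IntervalIntegrable (fun t => ∫ v in c..d, w v * G (v + (t - e))) volume a b := by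
  have hint := integrableOn_mul_comp_add hw hG a b c d e
  rw [IntegrableOn, Measure.volume_eq_prod, ← Measure.prod_restrict] at hint
  simp only [intervalIntegrable_iff, intervalIntegral.intervalIntegral_eq_integral_uIoc]
  exact hint.integral_prod_left.smul (if c ≤ d then (1 : ℝ) else -1)

/-- Young's convolution inequality `‖w ∗ G‖₁ ≤ ‖w‖₁ ‖G‖₁` on intervals. -/
theorem integral_integral_mul_comp_le {w G : ℝ → ℝ} {a d T : ℝ} (hw : Continuous w)
    (hw0 : ∀ v ∈ Icc 0 d, 0 ≤ w v) (hG : LocPrecompact G) (hG0 : ∀ t, 0 ≤ G t)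
    (hd : 0 ≤ d) (hda : d ≤ a) (haT : a ≤ T) :
    ∫ t in a..T, ∫ v in 0..d, w v * G (v + (t - d)) ≤ (∫ v in 0..d, w v) * ∫ t in 0..T, G t := by
  rw [intervalIntegral_intervalIntegral_swap (integrableOn_mul_comp_add hw hG a T 0 d d),
    ← intervalIntegral.integral_mul_const]
  have hshift (v : ℝ) : ∫ t in a..T, w v * G (v + (t - d)) =
      w v * ∫ t in v - d + a..v - d + T, G t := by
    rw [intervalIntegral.integral_const_mul, ← intervalIntegral.integral_comp_add_left]
    simp only [add_sub, sub_add_eq_add_sub]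
  simp only [hshift]
  have hprim : Continuous fun v => ∫ t in v - d + a..v - d + T, G t := by
    have hF := intervalIntegral.continuous_primitive hG.intervalIntegrable 0
    have hsub (v : ℝ) := intervalIntegral.integral_interval_sub_left
      (hG.intervalIntegrable 0 (v - d + T)) (hG.intervalIntegrable 0 (v - d + a))
    simp only [← hsub]
    fun_prop
  refine intervalIntegral.integral_mono_on hd ((hw.mul hprim).intervalIntegrable _ _)
    ((hw.intervalIntegrable _ _).mul_const _) fun v hv => ?_
  refine mul_le_mul_of_nonneg_left ?_ (hw0 v hv)
  exact intervalIntegral.integral_mono_interval (by linarith [hv.1]) (by linarith)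
    (by linarith [hv.2]) (ae_of_all _ hG0) (hG.intervalIntegrable _ _)

theorem exp_mul_sq_norm_taylorSum_sub_le [CompleteSpace E] {φ : ℕ → ℝ → E} {s : ℕ} {α d t : ℝ}
    (hα : 0 ≤ α) (hd : 0 ≤ d) (hφc : ∀ j ≤ s, ContinuousOn (φ j) (Icc (t - d) t))
    (hφ : ∀ j ≤ s, ∀ v ∈ Ioo (t - d) t, HasDerivWithinAt (φ j) (φ (j + 1) v) (Ioi v) v)
    (hφs : LocPrecompact (φ (s + 1))) :
    Real.exp (2 * α * t) *
        ‖∑ j ∈ Finset.range (s + 1), ((-d) ^ j / (j.factorial : ℝ)) • φ j t - φ 0 (t - d)‖ ^ 2 ≤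
      d ^ (s + 1) / ((s + 1).factorial : ℝ) * Real.exp (2 * α * d) *
        ∫ v in 0..d, v ^ s / (s.factorial : ℝ) *
          (Real.exp (2 * α * (v + (t - d))) * ‖φ (s + 1) (v + (t - d))‖ ^ 2) := by
  have hφn : LocPrecompact fun v => ‖φ (s + 1) (v + (t - d))‖ ^ 2 :=
    (hφs.comp_add_const (t - d)).continuous_comp (g := fun z => ‖z‖ ^ 2) (by fun_prop)
  have hweight : Real.exp (2 * α * t) *
        ∫ v in 0..d, v ^ s / (s.factorial : ℝ) * ‖φ (s + 1) (v + (t - d))‖ ^ 2 ≤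
      Real.exp (2 * α * d) * ∫ v in 0..d, v ^ s / (s.factorial : ℝ) *
        (Real.exp (2 * α * (v + (t - d))) * ‖φ (s + 1) (v + (t - d))‖ ^ 2) := by
    rw [← intervalIntegral.integral_const_mul, ← intervalIntegral.integral_const_mul]
    refine intervalIntegral.integral_mono_on hd ?_ ?_ fun v hv => ?_
    · exact ((hφn.continuous_mul (by fun_prop)).intervalIntegrable _ _).const_mul _
    · exact (((hφn.continuous_mul (by fun_prop)).continuous_mul
        (by fun_prop)).intervalIntegrable _ _).const_mul _
    have hexp : Real.exp (2 * α * t) ≤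
        Real.exp (2 * α * d) * Real.exp (2 * α * (v + (t - d))) := by
      rw [← Real.exp_add]
      exact Real.exp_le_exp.2 (by linarith [mul_nonneg hα hv.1])
    have hw0 : 0 ≤ v ^ s / (s.factorial : ℝ) := by
      have := hv.1
      positivity
    linarith [mul_le_mul_of_nonneg_right hexp
      (mul_nonneg hw0 (sq_nonneg ‖φ (s + 1) (v + (t - d))‖))]
  have hρ : 0 ≤ d ^ (s + 1) / ((s + 1).factorial : ℝ) := by positivity
  linarith [mul_le_mul_of_nonneg_left hweight hρ, mul_le_mul_of_nonneg_left
    (sq_norm_taylorSum_sub_le hd hφc hφ hφs) (Real.exp_nonneg (2 * α * t))]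

theorem taylor_error_inequality [CompleteSpace E] {φ : ℕ → ℝ → E} {s : ℕ} {α d a T : ℝ}
    (hα : 0 ≤ α) (hd : 0 < d) (hda : d ≤ a) (haT : a ≤ T) (hφc : ∀ j ≤ s, Continuous (φ j))
    (hφ : ∀ j ≤ s, ∀ t, 0 ≤ t → HasDerivWithinAt (φ j) (φ (j + 1) t) (Ioi t) t)
    (hφs : LocPrecompact (φ (s + 1))) :
    ((s + 1).factorial : ℝ) ^ 2 * (Real.exp (-2 * α * d) / d ^ (s + 1)) *
        ∫ t in a..T, Real.exp (2 * α * t) *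
          ‖∑ j ∈ Finset.range (s + 1), ((-d) ^ j / (j.factorial : ℝ)) • φ j t - φ 0 (t - d)‖ ^ 2 ≤
      d ^ (s + 1) * ∫ t in 0..T, Real.exp (2 * α * t) * ‖φ (s + 1) t‖ ^ 2 := by
  set w : ℝ → ℝ := fun v => v ^ s / (s.factorial : ℝ)
  set G : ℝ → ℝ := fun t => Real.exp (2 * α * t) * ‖φ (s + 1) t‖ ^ 2
  set ρ : ℝ := d ^ (s + 1) / ((s + 1).factorial : ℝ) with hρ
  have hwc : Continuous w := by fun_prop
  have hw0 : ∀ v ∈ Icc 0 d, 0 ≤ w v := fun v hv => by have := hv.1; positivity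
  have hGp : LocPrecompact G := (hφs.continuous_comp (g := fun z => ‖z‖ ^ 2)
    (by fun_prop)).continuous_mul (by fun_prop)
  have hint : IntervalIntegrable (fun t => Real.exp (2 * α * t) *
      ‖∑ j ∈ Finset.range (s + 1), ((-d) ^ j / (j.factorial : ℝ)) • φ j t - φ 0 (t - d)‖ ^ 2)
      volume a T := by
    refine Continuous.intervalIntegrable (Continuous.mul (by fun_prop) (Continuous.pow
      (Continuous.norm (Continuous.sub (continuous_finsetSum _ fun j hj => ?_) ?_)) 2)) _ _
    · exact (hφc j (Nat.lt_succ_iff.1 (Finset.mem_range.1 hj))).const_smul _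
    · exact (hφc 0 (Nat.zero_le s)).comp (by fun_prop)
  have hbound : ∫ t in a..T, Real.exp (2 * α * t) *
      ‖∑ j ∈ Finset.range (s + 1), ((-d) ^ j / (j.factorial : ℝ)) • φ j t - φ 0 (t - d)‖ ^ 2 ≤
      ρ * Real.exp (2 * α * d) * (ρ * ∫ t in 0..T, G t) := by
    refine (intervalIntegral.integral_mono_on haT hint
      ((intervalIntegrable_integral_mul_comp_add hwc hGp _ _ _ _ _).const_mul _)
      fun t ht => exp_mul_sq_norm_taylorSum_sub_le hα hd.le
        (fun j hj => (hφc j hj).continuousOn)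
        (fun j hj v hv => hφ j hj v (by linarith [hv.1, ht.1])) hφs).trans ?_
    rw [intervalIntegral.integral_const_mul]
    refine mul_le_mul_of_nonneg_left ?_ (by positivity)
    rw [hρ, ← integral_pow_div_factorial]
    exact integral_integral_mul_comp_le hwc hw0 hGp (fun t => by positivity) hd.le hda haT
  refine (mul_le_mul_of_nonneg_left hbound (by positivity)).trans_eq ?_
  rw [show -2 * α * d = -(2 * α * d) by ring, Real.exp_neg, hρ]
  field_simp

end Taylor

section Errors

variable {n m l s : ℕ} (A : Matrix (Fin n) (Fin n) ℝ) (B : Matrix (Fin n) (Fin m) ℝ)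
  (C : Matrix (Fin l) (Fin n) ℝ) (K : Fin (s + 1) → Matrix (Fin m) (Fin l) ℝ) (q : Fin s → ℕ)
  (h : ℝ)

theorem matK_mulVec_uncurry (w : Fin (s + 1) → Fin l → ℝ) :
    matK K *ᵥ Function.uncurry w = ∑ i, K i *ᵥ w i := by
  ext
  simp [matK, Matrix.mulVec, dotProduct, Fintype.sum_prod_type]

theorem matM_mulVec_uncurry (w : Fin (s + 1) → Fin l → ℝ) :
    matM l q h *ᵥ Function.uncurry w = Function.uncurry fun i =>
      ∑ j : Fin (s + 1), ((-(delay q i * h)) ^ (j : ℕ) / ((j : ℕ).factorial : ℝ)) • w j := by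
  ext ⟨i, a⟩
  simp [matM, Matrix.mulVec, dotProduct, Fintype.sum_prod_type]

theorem matF_mulVec (x : Fin n → ℝ) :
    matF A C K q h *ᵥ x = ∑ i, K i *ᵥ ∑ j ∈ Finset.range (s + 1),
      ((-(delay q i * h)) ^ j / (j.factorial : ℝ)) • ((C * A ^ j) *ᵥ x) := by
  have hC : matCbar s A C *ᵥ x = Function.uncurry fun j : Fin (s + 1) => (C * A ^ (j : ℕ)) *ᵥ x :=
    rfl
  rw [matF, ← Matrix.mulVec_mulVec, ← Matrix.mulVec_mulVec, hC, matM_mulVec_uncurry,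
    matK_mulVec_uncurry]
  simp only [Finset.sum_range]

/-- The error `Kᵢ (y(t_k - qᵢ h) - y(t - qᵢ h))`, `t ∈ [t_k, t_{k+1})`, due to sampling. -/
noncomputable def samplingError (x : ℝ → Fin n → ℝ) (t : ℝ) (i : Fin (s + 1)) : Fin m → ℝ :=
  K i *ᵥ (C *ᵥ (x (⌊t / h⌋₊ * h - delay q i * h) - x (t - delay q i * h)))

/-- The error of the Taylor approximation `∑ⱼ (-qᵢ h)ʲ / j! K C Aʲ x(t)` of `K y(t - qᵢ h)`, where
`K` is the gain that goes with `qᵢ`. -/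
noncomputable def taylorError (x : ℝ → Fin n → ℝ) (t : ℝ) (i : Fin s) : Fin m → ℝ :=
  K i.succ *ᵥ (C *ᵥ x (t - q i * h) - ∑ j ∈ Finset.range (s + 1),
    ((-(q i * h)) ^ j / (j.factorial : ℝ)) • ((C * A ^ j) *ᵥ x t))

variable {h}

theorem natCast_mul_le_floor_div_mul (hh : 0 < h) {N : ℕ} {t : ℝ} (ht : N * h ≤ t) :
    N * h ≤ ⌊t / h⌋₊ * h := by
  gcongr
  exact Nat.le_floor ((le_div_iff₀ hh).2 ht)

variable {q}

theorem control_eq_sum_errors (hh : 0 < h) {N : ℕ} (hN : ∀ i, delay q i ≤ N) (x : ℝ → Fin n → ℝ)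
    {t : ℝ} (ht : N * h ≤ t) :
    control C K q h x ⌊t / h⌋₊ = matF A C K q h *ᵥ x t +
      ∑ i, samplingError C K q h x t i + ∑ i, taylorError A C K q h x t i := by
  have houtput (i : Fin (s + 1)) : output C x (⌊t / h⌋₊ * h - delay q i * h) =
      C *ᵥ x (⌊t / h⌋₊ * h - delay q i * h) := by
    refine if_neg (not_lt.2 (sub_nonneg.2 (le_trans ?_ (natCast_mul_le_floor_div_mul hh ht))))
    gcongr
    exact hN i
  have hcontrol : control C K q h x ⌊t / h⌋₊ =
      ∑ i, K i *ᵥ (C *ᵥ x (⌊t / h⌋₊ * h - delay q i * h)) := by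
    rw [← Finset.sum_congr rfl fun i _ => congrArg (K i *ᵥ ·) (houtput i), Fin.sum_univ_succ]
    simp only [control, delay, Fin.cons_zero, Fin.cons_succ, Nat.cast_zero, zero_mul, sub_zero]
  have hzero : ∑ j ∈ Finset.range (s + 1),
      ((-(((0 : ℕ) : ℝ) * h)) ^ j / (j.factorial : ℝ)) • ((C * A ^ j) *ᵥ x t) = C *ᵥ x t := by
    simp [Finset.sum_range_succ']
  rw [hcontrol, matF_mulVec]
  simp only [samplingError, taylorError, Fin.sum_univ_succ, Matrix.mulVec_sub,
    Finset.sum_sub_distrib, delay, Fin.cons_zero, Fin.cons_succ, hzero]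
  simp only [Nat.cast_zero, zero_mul, sub_zero]
  abel

end Errors

section Trajectories

variable {n m l s : ℕ} {A : Matrix (Fin n) (Fin n) ℝ} {B : Matrix (Fin n) (Fin m) ℝ}
  {C : Matrix (Fin l) (Fin n) ℝ} {K : Fin (s + 1) → Matrix (Fin m) (Fin l) ℝ} {q : Fin s → ℕ}
  {h σ : ℝ} {Ω : Matrix (Fin m) (Fin m) ℝ} {x : ℝ → Fin n → ℝ} {û : ℕ → Fin m → ℝ}

variable (A B h x û) in
/-- The right-hand side `A x(t) + B û_k`, `t ∈ [t_k, t_{k+1})`, of the closed loop. -/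
noncomputable def velocity (t : ℝ) : Fin n → ℝ := A *ᵥ x t + B *ᵥ û ⌊t / h⌋₊

theorem locPrecompact_velocity (hx : Continuous x) : LocPrecompact (velocity A B h x û) :=
  ((LocPrecompact.of_continuous hx).prodMk (.sampleHold û h)).continuous_comp
    (g := fun z : (Fin n → ℝ) × (Fin m → ℝ) => A *ᵥ z.1 + B *ᵥ z.2) (by fun_prop)

theorem control_congr (hh : 0 < h) {x y : ℝ → Fin n → ℝ} {k : ℕ}
    (hxy : ∀ j ≤ k, x (j * h) = y (j * h)) : control C K q h x k = control C K q h y k := by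
  have houtput (i : ℕ) : output C x (k * h - i * h) = output C y (k * h - i * h) := by
    rcases lt_or_ge k i with hi | hi
    · have hneg : (k * h - i * h : ℝ) < 0 := sub_neg.2 (by gcongr)
      simp only [output, if_pos hneg]
    · simp only [output, ← sub_mul, ← Nat.cast_sub hi, hxy (k - i) (Nat.sub_le k i)]
  have hzero := houtput 0
  simp only [Nat.cast_zero, zero_mul, sub_zero] at hzero
  simp only [control, houtput, hzero]

theorem IsTrajectory.congr (hh : 0 < h) {x y : ℝ → Fin n → ℝ}
    (hx : IsTrajectory A B C K q h Ω σ x û) (hxy : EqOn x y (Ici 0)) :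
    IsTrajectory A B C K q h Ω σ y û := by
  have hsample (k : ℕ) : (0 : ℝ) ≤ k * h := by positivity
  have hcontrol (k : ℕ) : control C K q h x k = control C K q h y k :=
    control_congr hh fun j _ => hxy (hsample j)
  refine ⟨hx.continuousOn.congr hxy.symm, fun k t ht => ?_, ?_, fun k => ?_, fun k => ?_⟩
  · have ht0 : 0 ≤ t := (hsample k).trans ht.1
    rw [← hxy ht0]
    exact (hx.hasDeriv k t ht).congr (fun v hv => (hxy ((hsample k).trans hv)).symm) (hxy ht0).symm
  · rw [← hcontrol, hx.init]
  · rw [← hcontrol]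
    exact hx.transmit k
  · rw [← hcontrol]
    exact hx.hold k

theorem IsTrajectory.hasDerivWithinAt_Ioi (hx : IsTrajectory A B C K q h Ω σ x û) (hh : 0 < h)
    {t : ℝ} (ht : 0 ≤ t) : HasDerivWithinAt x (velocity A B h x û t) (Ioi t) t := by
  have hfloor : ⌊t / h⌋₊ * h ≤ t := (le_div_iff₀ hh).1 (Nat.floor_le (by positivity))
  exact (hx.hasDeriv _ t ⟨hfloor, (div_lt_iff₀ hh).1 (Nat.lt_floor_add_one _)⟩).mono
    (Ioi_subset_Ici hfloor)

theorem mulVec_velocity {j : ℕ} (hCB : C * A ^ j * B = 0) (t : ℝ) :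
    (C * A ^ j) *ᵥ velocity A B h x û t = (C * A ^ (j + 1)) *ᵥ x t := by
  rw [velocity, Matrix.mulVec_add, Matrix.mulVec_mulVec, Matrix.mulVec_mulVec, hCB,
    Matrix.zero_mulVec, add_zero, pow_succ, Matrix.mul_assoc]

theorem quadForm_sub_control_le (hσΩ : (σ • Ω).PosSemidef)
    (hx : IsTrajectory A B C K q h Ω σ x û) (k : ℕ) :
    quadForm Ω (û k - control C K q h x k) ≤ σ * quadForm Ω (control C K q h x k) := by
  have hnonneg : 0 ≤ σ * quadForm Ω (control C K q h x k) := by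
    rw [← quadForm_smul]
    exact quadForm_nonneg hσΩ _
  have hzero : quadForm Ω (0 : Fin m → ℝ) = 0 := by simp [quadForm]
  cases k with
  | zero => rwa [hx.init, sub_self, hzero]
  | succ k =>
    by_cases htrig : Triggered Ω σ (control C K q h x (k + 1)) (û k)
    · rwa [hx.transmit k htrig, sub_self, hzero]
    · rw [hx.hold k htrig, ← neg_sub]
      simpa only [quadForm, Matrix.mulVec_neg, neg_dotProduct, dotProduct_neg, neg_neg]
        using not_lt.1 htrig

end Trajectories

section Energy

variable {n m l s : ℕ} {A : Matrix (Fin n) (Fin n) ℝ} {B : Matrix (Fin n) (Fin m) ℝ}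
  {C : Matrix (Fin l) (Fin n) ℝ} {K : Fin (s + 1) → Matrix (Fin m) (Fin l) ℝ} {q : Fin s → ℕ}
  {h α σ : ℝ} {Ω : Matrix (Fin m) (Fin m) ℝ}
  {W : Fin (s + 1) → Matrix (Fin m) (Fin m) ℝ} {R : Fin s → Matrix (Fin m) (Fin m) ℝ}
  {x : ℝ → Fin n → ℝ} {û : ℕ → Fin m → ℝ}

theorem locPrecompact_samplingError (hx : Continuous x) (i : Fin (s + 1)) :
    LocPrecompact fun t => samplingError C K q h x t i :=
  ((LocPrecompact.sampleHold (fun k => x (k * h - delay q i * h)) h).prodMk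
    (.of_continuous (hx.comp (continuous_sub_right (delay q i * h))))).continuous_comp
    (g := fun z : (Fin n → ℝ) × (Fin n → ℝ) => K i *ᵥ (C *ᵥ (z.1 - z.2))) (by fun_prop)

theorem continuous_taylorError (hx : Continuous x) (i : Fin s) :
    Continuous fun t => taylorError A C K q h x t i := by
  simp only [taylorError]
  fun_prop

theorem hasDerivWithinAt_clm_mulVec {E : Type*} [NormedAddCommGroup E] [NormedSpace ℝ E]
    (L : (Fin m → ℝ) →L[ℝ] E) (X : Matrix (Fin m) (Fin n) ℝ) {v : Fin n → ℝ} {S : Set ℝ} {t : ℝ}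
    (hx : HasDerivWithinAt x v S t) :
    HasDerivWithinAt (fun τ => L (X *ᵥ x τ)) (L (X *ᵥ v)) S t :=
  (L ∘L (Matrix.mulVecLin X).toContinuousLinearMap).hasFDerivAt.comp_hasDerivWithinAt t hx

theorem integral_samplingError_le (hα : 0 ≤ α) (hh : 0 < h) (hx : Continuous x)
    (htraj : IsTrajectory A B C K q h Ω σ x û) (hCB : C * B = 0) {i : Fin (s + 1)}
    (hW : (W i).PosSemidef) {N : ℕ} (hN : delay q i ≤ N) {T : ℝ} (hT : N * h ≤ T) :
    Real.pi ^ 2 / 4 * (Real.exp (-2 * α * (delay q i * h)) *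
        ∫ t in N * h..T, Real.exp (2 * α * t) * quadForm (W i) (samplingError C K q h x t i)) ≤
      h ^ 2 * Real.exp (2 * α * h) *
        ∫ t in 0..T, Real.exp (2 * α * t) * quadForm (W i) (K i *ᵥ (C *ᵥ (A *ᵥ x t))) := by
  obtain ⟨L, hL⟩ := exists_quadForm_eq_norm_sq hW
  set g : ℝ → EuclideanSpace ℝ (Fin m) := fun t => L ((K i * C) *ᵥ x t) with hg
  have hgc : Continuous g := by fun_prop
  have hg' (t : ℝ) (ht : 0 ≤ t) :
      HasDerivWithinAt g (L (K i *ᵥ (C *ᵥ (A *ᵥ x t)))) (Ioi t) t := by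
    have hvel : C *ᵥ velocity A B h x û t = C *ᵥ (A *ᵥ x t) := by
      simpa [pow_succ] using mulVec_velocity (j := 0) (by simpa using hCB) t
    rw [← hvel, Matrix.mulVec_mulVec]
    exact hasDerivWithinAt_clm_mulVec L (K i * C) (htraj.hasDerivWithinAt_Ioi hh ht)
  have hNh : 0 ≤ N * h := by positivity
  have hdelay : delay q i * h ≤ N * h := by gcongr
  have hshift (t : ℝ) (ht : t ∈ uIcc (N * h) T) :
      quadForm (W i) (samplingError C K q h x t i) =
        ‖g (⌊(t - delay q i * h) / h⌋₊ * h) - g (t - delay q i * h)‖ ^ 2 := by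
    rw [uIcc_of_le hT] at ht
    have hfloor := floor_sub_natCast_mul_div_mul hh (hdelay.trans ht.1)
    rw [hL, hfloor, hg, samplingError, Matrix.mulVec_mulVec, Matrix.mulVec_sub, map_sub]
  calc _ = Real.pi ^ 2 / 4 * (Real.exp (-2 * α * (delay q i * h)) *
        ∫ t in N * h..T, Real.exp (2 * α * t) *
          ‖g (⌊(t - delay q i * h) / h⌋₊ * h) - g (t - delay q i * h)‖ ^ 2) := by
        rw [intervalIntegral.integral_congr fun t ht =>
          congrArg (Real.exp (2 * α * t) * ·) (hshift t ht)]
    _ ≤ Real.pi ^ 2 / 4 * ∫ t in 0..T, Real.exp (2 * α * t) * ‖g (⌊t / h⌋₊ * h) - g t‖ ^ 2 := by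
        gcongr
        exact integral_exp_mul_comp_sub_le (locPrecompact_sq_norm_sample_sub hgc h)
          (fun t => by positivity) (by positivity) hdelay hT
    _ ≤ _ := by
        simp only [hL]
        exact sampling_inequality hα hh hgc (.of_continuous (by fun_prop)) hg' (hNh.trans hT)

theorem integral_taylorError_le (hα : 0 ≤ α) (hh : 0 < h) (hx : Continuous x)
    (htraj : IsTrajectory A B C K q h Ω σ x û) (hCB : ∀ j < s, C * A ^ j * B = 0) {i : Fin s}
    (hq : 0 < q i) (hR : (R i).PosSemidef) {N : ℕ} (hN : q i ≤ N) {T : ℝ} (hT : N * h ≤ T) :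
    ((s + 1).factorial : ℝ) ^ 2 * (Real.exp (-2 * α * (q i * h)) / ((q i : ℝ) * h) ^ (s + 1) *
        ∫ t in N * h..T, Real.exp (2 * α * t) * quadForm (R i) (taylorError A C K q h x t i)) ≤
      ((q i : ℝ) * h) ^ (s + 1) * ∫ t in 0..T, Real.exp (2 * α * t) *
        quadForm (R i) (K i.succ *ᵥ ((C * A ^ s) *ᵥ velocity A B h x û t)) := by
  obtain ⟨L, hL⟩ := exists_quadForm_eq_norm_sq hR
  set φ : ℕ → ℝ → EuclideanSpace ℝ (Fin m) := Function.update
    (fun j t => L ((K i.succ * (C * A ^ j)) *ᵥ x t)) (s + 1)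
    fun t => L ((K i.succ * (C * A ^ s)) *ᵥ velocity A B h x û t) with hφ
  have hφs : φ (s + 1) = fun t => L ((K i.succ * (C * A ^ s)) *ᵥ velocity A B h x û t) :=
    Function.update_self ..
  have hφj (j : ℕ) (hj : j ≤ s) : φ j = fun t => L ((K i.succ * (C * A ^ j)) *ᵥ x t) :=
    Function.update_of_ne (by omega) _ _
  have hderiv (j : ℕ) (hj : j ≤ s) (t : ℝ) (ht : 0 ≤ t) :
      HasDerivWithinAt (φ j) (φ (j + 1) t) (Ioi t) t := by
    rw [hφj j hj]
    have := hasDerivWithinAt_clm_mulVec L (K i.succ * (C * A ^ j))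
      (htraj.hasDerivWithinAt_Ioi hh ht)
    rcases hj.eq_or_lt with rfl | hjs
    · rwa [hφs]
    · rw [hφj (j + 1) hjs]
      rwa [← Matrix.mulVec_mulVec, mulVec_velocity (hCB j hjs), Matrix.mulVec_mulVec] at this
  have htaylor (t : ℝ) : quadForm (R i) (taylorError A C K q h x t i) =
      ‖∑ j ∈ Finset.range (s + 1), ((-(q i * h)) ^ j / (j.factorial : ℝ)) • φ j t -
        φ 0 (t - q i * h)‖ ^ 2 := by
    rw [hL, norm_sub_rev, Finset.sum_congr rfl fun j hj => by
      rw [hφj j (Nat.lt_succ_iff.1 (Finset.mem_range.1 hj))], hφj 0 (Nat.zero_le s)]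
    simp only [taylorError, Matrix.mulVec_sub, Matrix.mulVec_sum, Matrix.mulVec_smul,
      Matrix.mulVec_mulVec, map_sub, map_sum, map_smul, pow_zero, Matrix.mul_one]
  have := taylor_error_inequality (d := q i * h) hα (by positivity) (by gcongr) hT
    (fun j hj => by rw [hφj j hj]; fun_prop) hderiv
    (hφs ▸ (locPrecompact_velocity hx).continuous_comp (g := fun z => L (_ *ᵥ z)) (by fun_prop))
  simpa only [htaylor, hL, hφs, Matrix.mulVec_mulVec, mul_assoc] using this

theorem integral_sum_add_sum {ι κ : Type*} [Fintype ι] [Fintype κ] {f : ι → ℝ → ℝ} {g : κ → ℝ → ℝ}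
    {a b : ℝ} (hf : ∀ i, IntervalIntegrable (f i) volume a b)
    (hg : ∀ i, IntervalIntegrable (g i) volume a b) :
    ∫ t in a..b, (∑ i, f i t + ∑ i, g i t) =
      ∑ i, (∫ t in a..b, f i t) + ∑ i, ∫ t in a..b, g i t := by
  rw [← intervalIntegral.integral_finsetSum fun i _ => hf i,
    ← intervalIntegral.integral_finsetSum fun i _ => hg i]
  exact intervalIntegral.integral_add
    (by simpa only [Finset.sum_fn] using IntervalIntegrable.sum _ fun i _ => hf i)
    (by simpa only [Finset.sum_fn] using IntervalIntegrable.sum _ fun i _ => hg i)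

theorem integral_exp_mul_errorCost {δ : ℝ → Fin (s + 1) → Fin m → ℝ} {κ : ℝ → Fin s → Fin m → ℝ}
    (hδ : ∀ i, LocPrecompact fun t => δ t i) (hκ : ∀ i, LocPrecompact fun t => κ t i) (a b : ℝ) :
    ∫ t in a..b, Real.exp (2 * α * t) * errorCost q h α W R (δ t) (κ t) =
      ∑ i, Real.pi ^ 2 / 4 * (Real.exp (-2 * α * (delay q i * h)) *
          ∫ t in a..b, Real.exp (2 * α * t) * quadForm (W i) (δ t i)) +
        ∑ i, ((s + 1).factorial : ℝ) ^ 2 *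
          (Real.exp (-2 * α * (q i * h)) / ((q i : ℝ) * h) ^ (s + 1) *
          ∫ t in a..b, Real.exp (2 * α * t) * quadForm (R i) (κ t i)) := by
  have hW (i : Fin (s + 1)) : IntervalIntegrable
      (fun t => Real.exp (2 * α * t) * quadForm (W i) (δ t i)) volume a b :=
    (((hδ i).continuous_comp (continuous_quadForm (W i))).continuous_mul
      (by fun_prop)).intervalIntegrable a b
  have hR (i : Fin s) : IntervalIntegrable
      (fun t => Real.exp (2 * α * t) * quadForm (R i) (κ t i)) volume a b :=
    (((hκ i).continuous_comp (continuous_quadForm (R i))).continuous_mul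
      (by fun_prop)).intervalIntegrable a b
  simp only [← intervalIntegral.integral_const_mul]
  rw [← integral_sum_add_sum (fun i => ((hW i).const_mul _).const_mul _)
    fun i => ((hR i).const_mul _).const_mul _]
  simp only [errorCost, mul_add, Finset.mul_sum, mul_left_comm (Real.exp (2 * α * _))]

theorem integral_exp_mul_errorBound {y v : ℝ → Fin n → ℝ} (hy : LocPrecompact y)
    (hv : LocPrecompact v) (a b : ℝ) :
    ∫ t in a..b, Real.exp (2 * α * t) * errorBound A C K q h α W R (y t) (v t) =
      ∑ i, h ^ 2 * Real.exp (2 * α * h) *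
          (∫ t in a..b, Real.exp (2 * α * t) * quadForm (W i) (K i *ᵥ (C *ᵥ (A *ᵥ y t)))) +
        ∑ i : Fin s, ((q i : ℝ) * h) ^ (s + 1) * ∫ t in a..b, Real.exp (2 * α * t) *
          quadForm (R i) (K i.succ *ᵥ ((C * A ^ s) *ᵥ v t)) := by
  have hW (i : Fin (s + 1)) : IntervalIntegrable (fun t => Real.exp (2 * α * t) *
      quadForm (W i) (K i *ᵥ (C *ᵥ (A *ᵥ y t)))) volume a b :=
    ((hy.continuous_comp (g := fun z => quadForm (W i) (K i *ᵥ (C *ᵥ (A *ᵥ z))))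
      (by fun_prop)).continuous_mul (by fun_prop)).intervalIntegrable a b
  have hR (i : Fin s) : IntervalIntegrable (fun t => Real.exp (2 * α * t) *
      quadForm (R i) (K i.succ *ᵥ ((C * A ^ s) *ᵥ v t))) volume a b :=
    ((hv.continuous_comp (g := fun z => quadForm (R i) (K i.succ *ᵥ ((C * A ^ s) *ᵥ z)))
      (by fun_prop)).continuous_mul (by fun_prop)).intervalIntegrable a b
  simp only [← intervalIntegral.integral_const_mul]
  rw [← integral_sum_add_sum (fun i => (hW i).const_mul _) fun i => (hR i).const_mul _]
  simp only [errorBound, mul_add, Finset.mul_sum, mul_left_comm (Real.exp (2 * α * _))]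

theorem integral_errorCost_le_integral_errorBound (hα : 0 ≤ α) (hh : 0 < h) (hx : Continuous x)
    (htraj : IsTrajectory A B C K q h Ω σ x û) (hs : 0 < s) (hCB : ∀ j < s, C * A ^ j * B = 0)
    (hq : ∀ i, 0 < q i) (hW : ∀ i, (W i).PosSemidef) (hR : ∀ i, (R i).PosSemidef) {N : ℕ}
    (hN : ∀ i, delay q i ≤ N) {T : ℝ} (hT : N * h ≤ T) :
    ∫ t in N * h..T, Real.exp (2 * α * t) * errorCost q h α W R
        (samplingError C K q h x t) (taylorError A C K q h x t) ≤
      ∫ t in 0..T, Real.exp (2 * α * t) *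
        errorBound A C K q h α W R (x t) (velocity A B h x û t) := by
  rw [integral_exp_mul_errorCost (locPrecompact_samplingError hx)
      fun i => .of_continuous (continuous_taylorError hx i),
    integral_exp_mul_errorBound (.of_continuous hx) (locPrecompact_velocity hx)]
  exact add_le_add
    (Finset.sum_le_sum fun i _ => integral_samplingError_le hα hh hx htraj
      (by simpa using hCB 0 hs) (hW i) (hN i) hT)
    (Finset.sum_le_sum fun i _ => integral_taylorError_le hα hh hx htraj hCB (hq i) (hR i)
      (hN i.succ) hT)

end Energy

section Lyapunov

theorem hasDerivWithinAt_dotProduct {ι : Type*} [Fintype ι] {f g : ℝ → ι → ℝ} {f' g' : ι → ℝ}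
    {S : Set ℝ} {t : ℝ} (hf : HasDerivWithinAt f f' S t) (hg : HasDerivWithinAt g g' S t) :
    HasDerivWithinAt (fun τ => f τ ⬝ᵥ g τ) (f' ⬝ᵥ g t + f t ⬝ᵥ g') S t := by
  simp only [dotProduct, ← Finset.sum_add_distrib]
  exact HasDerivWithinAt.fun_sum fun i _ =>
    (hasDerivWithinAt_pi.1 hf i).mul (hasDerivWithinAt_pi.1 hg i)

theorem hasDerivWithinAt_quadForm {n : ℕ} {P : Matrix (Fin n) (Fin n) ℝ} (hP : P.IsHermitian)
    {x : ℝ → Fin n → ℝ} {v : Fin n → ℝ} {S : Set ℝ} {t : ℝ} (hx : HasDerivWithinAt x v S t) :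
    HasDerivWithinAt (fun τ => quadForm P (x τ)) (2 * (x t ⬝ᵥ (P *ᵥ v))) S t := by
  refine (hasDerivWithinAt_dotProduct hx
    (hasDerivWithinAt_clm_mulVec (.id ℝ _) P hx)).congr_deriv ?_
  rw [ContinuousLinearMap.id_apply, ContinuousLinearMap.id_apply, dotProduct_mulVec_comm hP v,
    two_mul]

variable {n m l s : ℕ} {A : Matrix (Fin n) (Fin n) ℝ} {B : Matrix (Fin n) (Fin m) ℝ}
  {C : Matrix (Fin l) (Fin n) ℝ} {K : Fin (s + 1) → Matrix (Fin m) (Fin l) ℝ} {q : Fin s → ℕ}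
  {h α σ : ℝ} {P : Matrix (Fin n) (Fin n) ℝ} {Ω : Matrix (Fin m) (Fin m) ℝ}
  {W : Fin (s + 1) → Matrix (Fin m) (Fin m) ℝ} {R : Fin s → Matrix (Fin m) (Fin m) ℝ}
  {x : ℝ → Fin n → ℝ} {û : ℕ → Fin m → ℝ}

theorem continuous_errorCost : Continuous fun z : (Fin (s + 1) → Fin m → ℝ) × (Fin s → Fin m → ℝ) =>
    errorCost q h α W R z.1 z.2 := by
  unfold errorCost
  fun_prop

theorem continuous_errorBound : Continuous fun z : (Fin n → ℝ) × (Fin n → ℝ) =>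
    errorBound A C K q h α W R z.1 z.2 := by
  unfold errorBound
  fun_prop

theorem locPrecompact_exp_mul_errorBound (hx : Continuous x) : LocPrecompact fun t =>
    Real.exp (2 * α * t) * errorBound A C K q h α W R (x t) (velocity A B h x û t) :=
  (((LocPrecompact.of_continuous hx).prodMk
    (locPrecompact_velocity hx)).continuous_comp continuous_errorBound).continuous_mul (by fun_prop)

theorem IsTrajectory.lyapunov_rate_le (htraj : IsTrajectory A B C K q h Ω σ x û) (hh : 0 < h)
    (hP : P.IsHermitian) (hR : ∀ i, (R i).IsHermitian)
    (hLMI : (-phiE A B C K q h α σ P Ω W R).PosSemidef) {N : ℕ} (hN : ∀ i, delay q i ≤ N) {t : ℝ}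
    (ht : N * h ≤ t) :
    2 * (x t ⬝ᵥ (P *ᵥ velocity A B h x û t)) + 2 * α * quadForm P (x t) ≤
      errorCost q h α W R (samplingError C K q h x t) (taylorError A C K q h x t) -
        errorBound A C K q h α W R (x t) (velocity A B h x û t) := by
  have htrigger := quadForm_sub_control_le (posSemidef_smul_trigger_of_lmi hLMI) htraj ⌊t / h⌋₊
  have hrate := EventTriggered.lyapunov_rate_le hP hR hLMI
    (control_eq_sum_errors A C K hh hN x ht) (v := velocity A B h x û t)
    (e := û ⌊t / h⌋₊ - control C K q h x ⌊t / h⌋₊) (by rw [velocity, add_sub_cancel])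
  linarith

theorem hasDerivWithinAt_exp_mul_quadForm (hP : P.IsHermitian) {v : Fin n → ℝ} {S : Set ℝ} {t : ℝ}
    (hx : HasDerivWithinAt x v S t) :
    HasDerivWithinAt (fun τ => Real.exp (2 * α * τ) * quadForm P (x τ))
      (Real.exp (2 * α * t) * (2 * (x t ⬝ᵥ (P *ᵥ v)) + 2 * α * quadForm P (x t))) S t := by
  have hexp : HasDerivWithinAt (fun τ => Real.exp (2 * α * τ))
      (Real.exp (2 * α * t) * (2 * α)) S t :=
    (((hasDerivAt_id t).const_mul (2 * α)).exp.congr_deriv (by simp)).hasDerivWithinAt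
  exact (hexp.mul (hasDerivWithinAt_quadForm hP hx)).congr_deriv (by ring)

theorem exp_mul_quadForm_le (hα : 0 ≤ α) (hh : 0 < h) (hx : Continuous x)
    (htraj : IsTrajectory A B C K q h Ω σ x û) (hs : 0 < s) (hCB : ∀ j < s, C * A ^ j * B = 0)
    (hq : ∀ i, 0 < q i) (hP : P.IsHermitian)
    (hLMI : (-phiE A B C K q h α σ P Ω W R).PosSemidef) {N : ℕ} (hN : ∀ i, delay q i ≤ N) {T : ℝ}
    (hT : N * h ≤ T) :
    Real.exp (2 * α * T) * quadForm P (x T) ≤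
      Real.exp (2 * α * (N * h)) * quadForm P (x (N * h)) + ∫ t in 0..N * h,
        Real.exp (2 * α * t) * errorBound A C K q h α W R (x t) (velocity A B h x û t) := by
  have hW := posSemidef_samplingWeight_of_lmi hLMI
  have hR := posSemidef_taylorWeight_of_lmi hh hq hLMI
  have hNh : (0 : ℝ) ≤ N * h := by positivity
  set cost : ℝ → ℝ := fun t => Real.exp (2 * α * t) * errorCost q h α W R
    (samplingError C K q h x t) (taylorError A C K q h x t) with hcost
  set bound : ℝ → ℝ := fun t => Real.exp (2 * α * t) *
    errorBound A C K q h α W R (x t) (velocity A B h x û t) with hbound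
  have hcost_int : LocPrecompact cost :=
    (((LocPrecompact.pi (locPrecompact_samplingError hx)).prodMk
      (.pi fun i => .of_continuous (continuous_taylorError hx i))).continuous_comp
        continuous_errorCost).continuous_mul (by fun_prop)
  have hbound_int : LocPrecompact bound := locPrecompact_exp_mul_errorBound hx
  have hgrowth : Real.exp (2 * α * T) * quadForm P (x T) -
      Real.exp (2 * α * (N * h)) * quadForm P (x (N * h)) ≤
        ∫ t in N * h..T, (cost t - bound t) := by
    refine intervalIntegral.sub_le_integral_of_hasDeriv_right_of_le hT (by fun_prop)
      (fun t ht => hasDerivWithinAt_exp_mul_quadForm hP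
        (htraj.hasDerivWithinAt_Ioi hh (hNh.trans ht.1.le)))
      ((intervalIntegrable_iff_integrableOn_Icc_of_le hT).1
        ((hcost_int.intervalIntegrable _ _).sub (hbound_int.intervalIntegrable _ _)))
      fun t ht => ?_
    rw [hcost, hbound, ← mul_sub]
    exact mul_le_mul_of_nonneg_left (htraj.lyapunov_rate_le hh hP
      (fun i => (hR i).isHermitian) hLMI hN ht.1.le) (Real.exp_pos _).le
  have henergy : ∫ t in N * h..T, cost t ≤ ∫ t in 0..T, bound t :=
    integral_errorCost_le_integral_errorBound hα hh hx htraj hs hCB hq hW hR hN hT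
  rw [intervalIntegral.integral_sub (hcost_int.intervalIntegrable _ _)
    (hbound_int.intervalIntegrable _ _)] at hgrowth
  rw [← intervalIntegral.integral_add_adjacent_intervals (hbound_int.intervalIntegrable 0 (N * h))
    (hbound_int.intervalIntegrable (N * h) T)] at henergy
  linarith

end Lyapunov

section Growth

open scoped Matrix.Norms.Operator

variable {n m l s : ℕ} {A : Matrix (Fin n) (Fin n) ℝ} {B : Matrix (Fin n) (Fin m) ℝ}
  {C : Matrix (Fin l) (Fin n) ℝ} {K : Fin (s + 1) → Matrix (Fin m) (Fin l) ℝ} {q : Fin s → ℕ}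
  {h σ : ℝ} {Ω : Matrix (Fin m) (Fin m) ℝ} {x : ℝ → Fin n → ℝ} {û : ℕ → Fin m → ℝ}

variable (A B) in
/-- The generator `(x, u) ↦ (A x + B u, 0)` of the evolution of the state together with the control
value between two sampling instants, when the control is held constant. -/
noncomputable def holdGenerator :
    ((Fin n → ℝ) × (Fin m → ℝ)) →L[ℝ] (Fin n → ℝ) × (Fin m → ℝ) :=
  ((A.mulVecLin.coprod B.mulVecLin).prod 0).toContinuousLinearMap

theorem norm_control_le (hh : 0 ≤ h) {k : ℕ} {M : ℝ} (hM : ∀ t ∈ Icc 0 (k * h), ‖x t‖ ≤ M) :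
    ‖control C K q h x k‖ ≤ (∑ i, ‖K i‖) * ‖C‖ * M := by
  have hkh : 0 ≤ k * h := by positivity
  have hM0 : 0 ≤ M := (norm_nonneg _).trans (hM 0 ⟨le_rfl, hkh⟩)
  have houtput (t : ℝ) (ht : t ≤ k * h) : ‖output C x t‖ ≤ ‖C‖ * M := by
    rw [output]
    split_ifs with h0
    · rw [norm_zero]
      positivity
    · grw [Matrix.linfty_opNorm_mulVec, hM t ⟨not_lt.1 h0, ht⟩]
  have hterm (i : Fin (s + 1)) (t : ℝ) (ht : t ≤ k * h) :
      ‖K i *ᵥ output C x t‖ ≤ ‖K i‖ * ‖C‖ * M := by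
    grw [Matrix.linfty_opNorm_mulVec, houtput t ht, mul_assoc]
  rw [Fin.sum_univ_succ, add_mul, add_mul, Finset.sum_mul, Finset.sum_mul]
  refine norm_add_le_of_le (hterm 0 _ le_rfl) (norm_sum_le_of_le _ fun i _ => hterm i.succ _ ?_)
  exact sub_le_self _ (by positivity)

theorem IsTrajectory.norm_le_exp_mul (htraj : IsTrajectory A B C K q h Ω σ x û) (hh : 0 ≤ h) {k : ℕ}
    {M : ℝ} (hx : ‖x (k * h)‖ ≤ M) (hû : ‖û k‖ ≤ M) {t : ℝ}
    (ht : t ∈ Icc (k * h) ((k + 1) * h)) :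
    ‖x t‖ ≤ Real.exp (‖holdGenerator A B‖ * h) * M := by
  have hkh : (0 : ℝ) ≤ k * h := by positivity
  have hM : 0 ≤ M := (norm_nonneg _).trans hx
  have hderiv (τ : ℝ) (hτ : τ ∈ Ico (k * h) ((k + 1) * h)) :
      HasDerivWithinAt (fun τ => (x τ, û k)) (holdGenerator A B (x τ, û k)) (Ici τ) τ :=
    ((htraj.hasDeriv k τ hτ).mono (Ici_subset_Ici.2 hτ.1)).prodMk (hasDerivWithinAt_const ..)
  have hgronwall := norm_le_gronwallBound_of_norm_deriv_right_le (ε := 0)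
    ((htraj.continuousOn.mono fun τ hτ => hkh.trans hτ.1).prodMk continuousOn_const)
    hderiv (max_le hx hû)
    (fun τ _ => (ContinuousLinearMap.le_opNorm _ _).trans_eq (add_zero _).symm)
    t ht
  rw [gronwallBound_ε0] at hgronwall
  have hth : t - k * h ≤ h := by linarith [ht.2]
  calc ‖x t‖ ≤ M * Real.exp (‖holdGenerator A B‖ * (t - k * h)) :=
        (norm_fst_le (x t, û k)).trans hgronwall
    _ ≤ Real.exp (‖holdGenerator A B‖ * h) * M := by
        rw [mul_comm]
        gcongr

theorem IsTrajectory.norm_control_succ_le (htraj : IsTrajectory A B C K q h Ω σ x û) {k : ℕ} {M : ℝ}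
    (hcontrol : ‖control C K q h x (k + 1)‖ ≤ M) (hû : ‖û k‖ ≤ M) : ‖û (k + 1)‖ ≤ M := by
  by_cases htrig : Triggered Ω σ (control C K q h x (k + 1)) (û k)
  · rwa [htraj.transmit k htrig]
  · rwa [htraj.hold k htrig]

variable (A B C K h Ω q σ) in
theorem exists_forall_norm_le_pow (hh : 0 ≤ h) : ∃ γ ρ : ℝ, 1 ≤ γ ∧ 1 ≤ ρ ∧
    ∀ (x : ℝ → Fin n → ℝ) (û : ℕ → Fin m → ℝ), IsTrajectory A B C K q h Ω σ x û → ∀ k : ℕ,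
      (∀ t ∈ Icc 0 (k * h), ‖x t‖ ≤ ρ ^ k * ‖x 0‖) ∧ ‖û k‖ ≤ γ * (ρ ^ k * ‖x 0‖) := by
  set γ := max 1 ((∑ i, ‖K i‖) * ‖C‖)
  set E := Real.exp (‖holdGenerator A B‖ * h)
  have hγ1 : 1 ≤ γ := le_max_left _ _
  have hE1 : 1 ≤ E := Real.one_le_exp (by positivity)
  have hρ1 : 1 ≤ E * γ := one_le_mul_of_one_le_of_one_le hE1 hγ1
  refine ⟨γ, E * γ, hγ1, hρ1, fun x û htraj k => ?_⟩
  have hcontrol {k : ℕ} {M : ℝ} (hM : ∀ t ∈ Icc 0 (k * h), ‖x t‖ ≤ M) :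
      ‖control C K q h x k‖ ≤ γ * M := by
    have hM0 : 0 ≤ M := (norm_nonneg _).trans (hM 0 ⟨le_rfl, by positivity⟩)
    exact (norm_control_le hh hM).trans (by gcongr; exact le_max_right _ _)
  induction k with
  | zero =>
    have hx0 (t : ℝ) (ht : t ∈ Icc 0 (((0 : ℕ) : ℝ) * h)) : ‖x t‖ ≤ (E * γ) ^ 0 * ‖x 0‖ := by
      rw [le_antisymm (by simpa using ht.2) ht.1, pow_zero, one_mul]
    exact ⟨hx0, htraj.init ▸ hcontrol hx0⟩
  | succ k ih =>
    obtain ⟨hxk, hûk⟩ := ih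
    have hmono : (E * γ) ^ k * ‖x 0‖ ≤ (E * γ) ^ (k + 1) * ‖x 0‖ := by gcongr; omega
    have hx (t : ℝ) (ht : t ∈ Icc 0 (((k + 1 : ℕ) : ℝ) * h)) :
        ‖x t‖ ≤ (E * γ) ^ (k + 1) * ‖x 0‖ := by
      rcases le_total t (k * h) with htk | htk
      · exact (hxk t ⟨ht.1, htk⟩).trans hmono
      · have hxkh : ‖x (k * h)‖ ≤ γ * ((E * γ) ^ k * ‖x 0‖) :=
          (hxk _ ⟨by positivity, le_rfl⟩).trans (le_mul_of_one_le_left (by positivity) hγ1)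
        refine (htraj.norm_le_exp_mul hh hxkh hûk ⟨htk, by exact_mod_cast ht.2⟩).trans_eq ?_
        rw [pow_succ]
        ring
    exact ⟨hx, htraj.norm_control_succ_le (hcontrol hx) (hûk.trans (by gcongr))⟩

end Growth

section Decay

variable {n m l s : ℕ} {A : Matrix (Fin n) (Fin n) ℝ} {B : Matrix (Fin n) (Fin m) ℝ}
  {C : Matrix (Fin l) (Fin n) ℝ} {K : Fin (s + 1) → Matrix (Fin m) (Fin l) ℝ} {q : Fin s → ℕ}
  {h α σ : ℝ} {P : Matrix (Fin n) (Fin n) ℝ} {Ω : Matrix (Fin m) (Fin m) ℝ}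
  {W : Fin (s + 1) → Matrix (Fin m) (Fin m) ℝ} {R : Fin s → Matrix (Fin m) (Fin m) ℝ}

theorem IsTrajectory.exists_continuous (hh : 0 < h) {x : ℝ → Fin n → ℝ} {û : ℕ → Fin m → ℝ}
    (htraj : IsTrajectory A B C K q h Ω σ x û) :
    ∃ y, Continuous y ∧ EqOn x y (Ici 0) ∧ IsTrajectory A B C K q h Ω σ y û := by
  have hxy : EqOn x (fun t => x (max t 0)) (Ici 0) := fun t ht => congrArg x (max_eq_left ht).symm
  exact ⟨_, htraj.continuousOn.comp_continuous (by fun_prop) fun t => le_max_right t 0, hxy,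
    htraj.congr hh hxy⟩

theorem exists_errorBound_le : ∃ c > 0, ∀ z : (Fin n → ℝ) × (Fin m → ℝ),
    errorBound A C K q h α W R z.1 (A *ᵥ z.1 + B *ᵥ z.2) ≤ c * ‖z‖ ^ 2 := by
  refine exists_le_const_mul_of_homogeneous
    (continuous_errorBound.comp (g := fun z : (Fin n → ℝ) × (Fin n → ℝ) =>
      errorBound A C K q h α W R z.1 z.2) (f := fun z : (Fin n → ℝ) × (Fin m → ℝ) =>
      (z.1, A *ᵥ z.1 + B *ᵥ z.2)) (by fun_prop)) (by fun_prop) (fun r z => ?_) (fun r z => ?_)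
    fun z hz => by positivity
  · simp only [errorBound, Prod.smul_fst, Prod.smul_snd, Matrix.mulVec_smul, ← smul_add,
      quadForm_smul_vec, ← Finset.mul_sum, mul_add, mul_left_comm (_ ^ _) (r ^ 2)]
    ring
  · rw [norm_smul, mul_pow, Real.norm_eq_abs, sq_abs]

variable (A B C K q h σ Ω) in
theorem exists_norm_prodMk_le (hh : 0 < h) (N : ℕ) :
    ∃ M > 0, ∀ (x : ℝ → Fin n → ℝ) (û : ℕ → Fin m → ℝ), IsTrajectory A B C K q h Ω σ x û →
      ∀ t ∈ Icc 0 (N * h), ‖(x t, û ⌊t / h⌋₊)‖ ≤ M * ‖x 0‖ := by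
  obtain ⟨γ, ρ, hγ, hρ, hgrowth⟩ := exists_forall_norm_le_pow A B C K q h σ Ω hh.le
  refine ⟨γ * ρ ^ N, by positivity, fun x û htraj t ht => max_le ?_ ?_⟩
  · calc ‖x t‖ ≤ ρ ^ N * ‖x 0‖ := (hgrowth x û htraj N).1 t ht
      _ ≤ γ * ρ ^ N * ‖x 0‖ := by
        gcongr
        exact le_mul_of_one_le_left (by positivity) hγ
  · have hk : ⌊t / h⌋₊ ≤ N := Nat.floor_le_of_le ((div_le_iff₀ hh).2 ht.2)
    calc ‖û ⌊t / h⌋₊‖ ≤ γ * (ρ ^ ⌊t / h⌋₊ * ‖x 0‖) := (hgrowth x û htraj _).2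
      _ ≤ γ * (ρ ^ N * ‖x 0‖) := by gcongr
      _ = γ * ρ ^ N * ‖x 0‖ := (mul_assoc ..).symm

theorem exists_integral_exp_mul_errorBound_le (hα : 0 ≤ α) (hh : 0 < h) (N : ℕ) :
    ∃ c ≥ 0, ∀ (x : ℝ → Fin n → ℝ) (û : ℕ → Fin m → ℝ), Continuous x →
      IsTrajectory A B C K q h Ω σ x û →
      ∫ t in 0..N * h, Real.exp (2 * α * t) *
        errorBound A C K q h α W R (x t) (velocity A B h x û t) ≤ c * ‖x 0‖ ^ 2 := by
  obtain ⟨M, hM, hsize⟩ := exists_norm_prodMk_le A B C K q h σ Ω hh N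
  obtain ⟨b, hb, hbound⟩ := exists_errorBound_le (A := A) (B := B) (C := C) (K := K) (q := q)
    (h := h) (α := α) (W := W) (R := R)
  have hNh : 0 ≤ N * h := by positivity
  refine ⟨N * h * (Real.exp (2 * α * (N * h)) * (b * M ^ 2)), by positivity, fun x û hx htraj => ?_⟩
  calc ∫ t in 0..N * h, Real.exp (2 * α * t) *
          errorBound A C K q h α W R (x t) (velocity A B h x û t)
      ≤ ∫ t in 0..N * h, Real.exp (2 * α * (N * h)) * (b * (M * ‖x 0‖) ^ 2) := by
        refine intervalIntegral.integral_mono_on hNh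
          ((locPrecompact_exp_mul_errorBound hx).intervalIntegrable _ _) (by simp) fun t ht => ?_
        calc _ ≤ Real.exp (2 * α * t) * (b * ‖(x t, û ⌊t / h⌋₊)‖ ^ 2) :=
              mul_le_mul_of_nonneg_left (hbound (x t, û ⌊t / h⌋₊)) (Real.exp_nonneg _)
          _ ≤ Real.exp (2 * α * (N * h)) * (b * (M * ‖x 0‖) ^ 2) := by
              gcongr
              exacts [ht.2, hsize x û htraj t ht]
    _ = N * h * (Real.exp (2 * α * (N * h)) * (b * M ^ 2)) * ‖x 0‖ ^ 2 := by
        rw [intervalIntegral.integral_const, sub_zero, smul_eq_mul]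
        ring

theorem exists_exp_mul_quadForm_le_of_mem_Icc (hα : 0 ≤ α) (hh : 0 < h) (N : ℕ) :
    ∃ c > 0, ∀ (x : ℝ → Fin n → ℝ) (û : ℕ → Fin m → ℝ), IsTrajectory A B C K q h Ω σ x û →
      ∀ t ∈ Icc 0 (N * h), Real.exp (2 * α * t) * quadForm P (x t) ≤ c * ‖x 0‖ ^ 2 := by
  obtain ⟨M, hM, hsize⟩ := exists_norm_prodMk_le A B C K q h σ Ω hh N
  obtain ⟨a, ha, hbound⟩ := exists_le_const_mul_of_homogeneous (continuous_quadForm P)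
    (g := fun z => ‖z‖ ^ 2) (by fun_prop) (quadForm_smul_vec P)
    (fun r z => by rw [norm_smul, mul_pow, Real.norm_eq_abs, sq_abs]) fun z hz => by positivity
  refine ⟨Real.exp (2 * α * (N * h)) * (a * M ^ 2), by positivity, fun x û htraj t ht => ?_⟩
  have hxt : ‖x t‖ ≤ M * ‖x 0‖ := (norm_fst_le (x t, û _)).trans (hsize x û htraj t ht)
  calc Real.exp (2 * α * t) * quadForm P (x t)
      ≤ Real.exp (2 * α * t) * (a * ‖x t‖ ^ 2) :=
        mul_le_mul_of_nonneg_left (hbound (x t)) (Real.exp_nonneg _)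
    _ ≤ Real.exp (2 * α * (N * h)) * (a * (M * ‖x 0‖) ^ 2) := by
        gcongr
        exact ht.2
    _ = Real.exp (2 * α * (N * h)) * (a * M ^ 2) * ‖x 0‖ ^ 2 := by ring

theorem exists_exp_mul_quadForm_le (hα : 0 ≤ α) (hh : 0 < h) (hs : 0 < s)
    (hCB : ∀ j < s, C * A ^ j * B = 0) (hq : ∀ i, 0 < q i) (hP : P.IsHermitian)
    (hLMI : (-phiE A B C K q h α σ P Ω W R).PosSemidef) :
    ∃ c > 0, ∀ (x : ℝ → Fin n → ℝ) (û : ℕ → Fin m → ℝ), IsTrajectory A B C K q h Ω σ x û →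
      ∀ t, 0 ≤ t → Real.exp (2 * α * t) * quadForm P (x t) ≤ c * ‖x 0‖ ^ 2 := by
  set N := Finset.univ.sup (delay q)
  have hN (i : Fin (s + 1)) : delay q i ≤ N := Finset.le_sup (Finset.mem_univ i)
  have hNh : 0 ≤ N * h := by positivity
  obtain ⟨c₁, hc₁, hinitial⟩ := exists_exp_mul_quadForm_le_of_mem_Icc (A := A) (B := B) (C := C)
    (K := K) (q := q) (P := P) (σ := σ) (Ω := Ω) hα hh N
  obtain ⟨c₂, hc₂, hintegral⟩ := exists_integral_exp_mul_errorBound_le (A := A) (B := B) (C := C)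
    (K := K) (q := q) (σ := σ) (Ω := Ω) (W := W) (R := R) hα hh N
  refine ⟨c₁ + c₂, by positivity, fun x û htraj t ht => ?_⟩
  obtain ⟨y, hy, hxy, htraj⟩ := htraj.exists_continuous hh
  rw [hxy ht, hxy (mem_Ici.2 le_rfl), add_mul]
  rcases le_total t (N * h) with htN | htN
  · exact (hinitial y û htraj t ⟨ht, htN⟩).trans (le_add_of_nonneg_right (by positivity))
  · exact (exp_mul_quadForm_le hα hh hy htraj hs hCB hq hP hLMI hN htN).trans
      (add_le_add (hinitial y û htraj _ ⟨hNh, le_rfl⟩) (hintegral y û hy htraj))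

theorem norm_le_euclNorm (v : Fin n → ℝ) : ‖v‖ ≤ euclNorm v :=
  (pi_norm_le_iff_of_nonneg (norm_nonneg _)).2 fun i =>
    PiLp.norm_apply_le (WithLp.toLp 2 v : EuclideanSpace ℝ (Fin n)) i

theorem euclNorm_smul (r : ℝ) (v : Fin n → ℝ) : euclNorm (r • v) = |r| * euclNorm v :=
  norm_smul r (WithLp.toLp 2 v : EuclideanSpace ℝ (Fin n))

theorem continuous_euclNorm : Continuous (euclNorm : (Fin n → ℝ) → ℝ) := by
  unfold euclNorm
  fun_prop

theorem exists_euclNorm_le_of_exp_mul_quadForm_le (hP : P.PosDef) {c : ℝ} (hc : 0 < c) :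
    ∃ c' > 0, ∀ (t : ℝ) (v x₀ : Fin n → ℝ),
      Real.exp (2 * α * t) * quadForm P v ≤ c * ‖x₀‖ ^ 2 →
        euclNorm v ≤ c' * Real.exp (-α * t) * euclNorm x₀ := by
  obtain ⟨p, hp, hpV⟩ := exists_le_const_mul_of_homogeneous (f := fun z => euclNorm z ^ 2)
    (continuous_euclNorm.pow 2) (continuous_quadForm P)
    (fun r z => by rw [euclNorm_smul, mul_pow, sq_abs]) (quadForm_smul_vec P)
    fun z hz => hP.dotProduct_mulVec_pos hz
  refine ⟨√(p * c), by positivity, fun t v x₀ hv => ?_⟩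
  have hx₀ : 0 ≤ euclNorm x₀ := norm_nonneg _
  refine le_of_sq_le_sq ?_ (by positivity)
  calc euclNorm v ^ 2 ≤ p * quadForm P v := hpV v
    _ = p * (Real.exp (-α * t) ^ 2 * (Real.exp (2 * α * t) * quadForm P v)) := by
        rw [← mul_assoc (_ ^ 2), ← Real.exp_nat_mul, ← Real.exp_add]
        ring_nf
        simp
    _ ≤ p * (Real.exp (-α * t) ^ 2 * (c * euclNorm x₀ ^ 2)) := by
        grw [hv, norm_le_euclNorm x₀]
    _ = (√(p * c) * Real.exp (-α * t) * euclNorm x₀) ^ 2 := by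
        rw [mul_pow, mul_pow, Real.sq_sqrt (by positivity)]
        ring

end Decay

section Existence

variable {n m l s : ℕ} (A : Matrix (Fin n) (Fin n) ℝ) (B : Matrix (Fin n) (Fin m) ℝ)
  (C : Matrix (Fin l) (Fin n) ℝ) (K : Fin (s + 1) → Matrix (Fin m) (Fin l) ℝ) (q : Fin s → ℕ)
  (h σ : ℝ) (Ω : Matrix (Fin m) (Fin m) ℝ) (x₀ : Fin n → ℝ) (u : Fin m → ℝ)

/-- The state at time `t` of `ẋ = A x + B u` with constant `u`, started at `x₀`. -/
noncomputable def heldFlow (t : ℝ) : Fin n → ℝ :=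
  (NormedSpace.exp (t • holdGenerator A B) (x₀, u)).1

theorem heldFlow_zero : heldFlow A B x₀ u 0 = x₀ := by
  simp [heldFlow]

theorem hasDerivAt_heldFlow (t : ℝ) :
    HasDerivAt (heldFlow A B x₀ u) (A *ᵥ heldFlow A B x₀ u t + B *ᵥ u) t := by
  set z : ℝ → (Fin n → ℝ) × (Fin m → ℝ) :=
    fun t => NormedSpace.exp (t • holdGenerator A B) (x₀, u)
  have hz (t : ℝ) : HasDerivAt z (A *ᵥ (z t).1 + B *ᵥ (z t).2, 0) t :=
    (hasDerivAt_exp_smul_const' (holdGenerator A B) t).clm_apply (hasDerivAt_const t (x₀, u))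
      |>.congr_deriv (by simp; rfl)
  have hsnd (t : ℝ) : HasDerivAt (fun t => (z t).2) 0 t :=
    (hasFDerivAt_snd (𝕜 := ℝ) (p := z t)).comp_hasDerivAt t (hz t)
  have hheld : (z t).2 = u := by
    have hconst := is_const_of_deriv_eq_zero (f := fun t => (z t).2)
      (fun t => (hsnd t).differentiableAt) (fun t => (hsnd t).deriv) t 0
    simpa [z] using hconst
  exact ((hasFDerivAt_fst (𝕜 := ℝ) (p := z t)).comp_hasDerivAt t (hz t)).congr_deriv
    (by rw [hheld]; rfl)

open Classical in
/-- The closed loop started at `x₀`, advanced over `k` sampling intervals: a function that is the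
state on `[0, k h]`, and the control value held on the next interval. -/
noncomputable def advance : ℕ → (ℝ → Fin n → ℝ) × (Fin m → ℝ)
  | 0 => (fun _ => x₀, control C K q h (fun _ => x₀) 0)
  | k + 1 =>
    let x : ℝ → Fin n → ℝ := fun t =>
      if t ≤ k * h then (advance k).1 t
      else heldFlow A B ((advance k).1 (k * h)) (advance k).2 (t - k * h)
    let u := control C K q h x (k + 1)
    (x, if Triggered Ω σ u (advance k).2 then u else (advance k).2)

theorem continuous_advance (k : ℕ) : Continuous (advance A B C K q h σ Ω x₀ k).1 := by
  induction k with
  | zero => exact continuous_const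
  | succ k ih =>
    have hflow : Continuous (heldFlow A B ((advance A B C K q h σ Ω x₀ k).1 (k * h))
        (advance A B C K q h σ Ω x₀ k).2) :=
      continuous_iff_continuousAt.2 fun t => (hasDerivAt_heldFlow ..).continuousAt
    refine ih.if_le (by fun_prop) continuous_id continuous_const fun t ht => ?_
    rw [ht, sub_self, heldFlow_zero]

variable {h}

theorem eqOn_advance (hh : 0 < h) {j k : ℕ} (hjk : j ≤ k) :
    EqOn (advance A B C K q h σ Ω x₀ k).1 (advance A B C K q h σ Ω x₀ j).1 (Iic (j * h)) := by
  induction k, hjk using Nat.le_induction with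
  | base => exact eqOn_refl _ _
  | succ k hjk ih =>
    intro t ht
    have htk : t ≤ k * h := ht.trans (by gcongr)
    exact (if_pos htk).trans (ih ht)

theorem exists_eqOn_advance (hh : 0 < h) :
    ∃ x, ∀ k : ℕ, EqOn x (advance A B C K q h σ Ω x₀ k).1 (Iic (k * h)) := by
  refine ⟨fun t => (advance A B C K q h σ Ω x₀ ⌈t / h⌉₊).1 t, fun k t ht => ?_⟩
  have hle : ⌈t / h⌉₊ ≤ k := Nat.ceil_le.2 ((div_le_iff₀ hh).2 ht)
  exact (eqOn_advance A B C K q σ Ω x₀ hh hle ((div_le_iff₀ hh).1 (Nat.le_ceil _))).symm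

variable {A B C K q σ Ω x₀}

theorem continuous_of_eqOn_advance (hh : 0 < h) {x : ℝ → Fin n → ℝ}
    (hx : ∀ k : ℕ, EqOn x (advance A B C K q h σ Ω x₀ k).1 (Iic (k * h))) : Continuous x := by
  refine continuous_iff_continuousAt.2 fun t => ?_
  obtain ⟨k, hk⟩ := exists_nat_gt (t / h)
  exact (continuous_advance A B C K q h σ Ω x₀ k).continuousAt.congr
    ((hx k).symm.eventuallyEq_of_mem (Iic_mem_nhds ((div_lt_iff₀ hh).1 hk)))

theorem eq_heldFlow_of_eqOn_advance {x : ℝ → Fin n → ℝ}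
    (hx : ∀ k : ℕ, EqOn x (advance A B C K q h σ Ω x₀ k).1 (Iic (k * h))) (k : ℕ) {t : ℝ}
    (ht : t ∈ Icc (k * h) ((k + 1) * h)) :
    x t = heldFlow A B (x (k * h)) (advance A B C K q h σ Ω x₀ k).2 (t - k * h) := by
  rcases ht.1.eq_or_lt with rfl | hlt
  · rw [sub_self, heldFlow_zero]
  · rw [hx (k + 1) (mem_Iic.2 (by exact_mod_cast ht.2)), hx k (mem_Iic.2 le_rfl)]
    exact if_neg hlt.not_ge

variable (A B C K q σ Ω x₀) in
theorem exists_isTrajectory (hh : 0 < h) :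
    ∃ x û, IsTrajectory A B C K q h Ω σ x û ∧ x 0 = x₀ := by
  obtain ⟨x, hx⟩ := exists_eqOn_advance A B C K q σ Ω x₀ hh
  have hcontrol (k : ℕ) :
      control C K q h x k = control C K q h (advance A B C K q h σ Ω x₀ k).1 k :=
    control_congr hh fun j hj => hx k (mem_Iic.2 (by gcongr))
  refine ⟨x, fun k => (advance A B C K q h σ Ω x₀ k).2,
    ⟨(continuous_of_eqOn_advance hh hx).continuousOn, fun k t ht => ?_, (hcontrol 0).symm,
      fun k htrig => ?_, fun k htrig => ?_⟩, hx 0 (by simp)⟩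
  · have hflow : HasDerivAt
        (fun v => heldFlow A B (x (k * h)) (advance A B C K q h σ Ω x₀ k).2 (v - k * h)) _ t :=
      (hasDerivAt_heldFlow ..).comp_sub_const t (k * h)
    rw [← eq_heldFlow_of_eqOn_advance hx k (Ico_subset_Icc_self ht)] at hflow
    refine hflow.hasDerivWithinAt.congr_of_eventuallyEq ?_
      (eq_heldFlow_of_eqOn_advance hx k (Ico_subset_Icc_self ht))
    filter_upwards [self_mem_nhdsWithin, mem_nhdsWithin_of_mem_nhds (Iio_mem_nhds ht.2)]
      with v hv hv'
    exact eq_heldFlow_of_eqOn_advance hx k ⟨hv, hv'.le⟩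
  · rw [hcontrol] at htrig ⊢
    exact if_pos htrig
  · rw [hcontrol] at htrig
    exact if_neg htrig

end Existence

end EventTriggered

theorem theorem2_general {n m l s : ℕ} (hs : 0 < s)
    (A : Matrix (Fin n) (Fin n) ℝ) (B : Matrix (Fin n) (Fin m) ℝ) (C : Matrix (Fin l) (Fin n) ℝ)
    (hCB : ∀ j < s, C * A ^ j * B = 0)
    (h : ℝ) (hh : 0 < h) (q : Fin s → ℕ) (hq : ∀ i, 0 < q i)
    (K : Fin (s + 1) → Matrix (Fin m) (Fin l) ℝ) (σ α : ℝ) (hα : 0 ≤ α)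
    (P : Matrix (Fin n) (Fin n) ℝ) (hP : P.PosDef) (Ω : Matrix (Fin m) (Fin m) ℝ)
    (W : Fin (s + 1) → Matrix (Fin m) (Fin m) ℝ) (R : Fin s → Matrix (Fin m) (Fin m) ℝ)
    (hLMI : (-(EventTriggered.phiE A B C K q h α σ P Ω W R)).PosSemidef) :
    EventTriggered.ExponentiallyStabilizes A B C K q h Ω σ α := by
  obtain ⟨c, hc, hquad⟩ :=
    EventTriggered.exists_exp_mul_quadForm_le hα hh hs hCB hq hP.isHermitian hLMI
  obtain ⟨c', hc', hnorm⟩ := EventTriggered.exists_euclNorm_le_of_exp_mul_quadForm_le hP hc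
  refine ⟨c', hc', fun x₀ =>
    ⟨EventTriggered.exists_isTrajectory A B C K q σ Ω x₀ hh, fun x û htraj hx₀ t ht => ?_⟩⟩
  exact hnorm t (x t) x₀ (hx₀ ▸ hquad x û htraj t ht)

theorem theorem2 {n m l s : ℕ} (hr : 2 ≤ s + 1)
    (A : Matrix (Fin n) (Fin n) ℝ) (B : Matrix (Fin n) (Fin m) ℝ) (C : Matrix (Fin l) (Fin n) ℝ)
    (hdeg : EventTriggered.HasRelativeDegree A B C (s + 1))
    (h : ℝ) (hh : 0 < h)
    (q : Fin s → ℕ) (hq_pos : ∀ i, 0 < q i) (hq_mono : StrictMono q)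
    (K : Fin (s + 1) → Matrix (Fin m) (Fin l) ℝ)
    (σ : ℝ) (hσ : σ ∈ Set.Ico (0 : ℝ) 1) (α : ℝ) (hα : 0 < α)
    (P : Matrix (Fin n) (Fin n) ℝ) (hP : P.PosDef)
    (Ω : Matrix (Fin m) (Fin m) ℝ) (hΩ : Ω.PosDef)
    (W : Fin (s + 1) → Matrix (Fin m) (Fin m) ℝ) (hW : ∀ i, (W i).PosDef)
    (R : Fin s → Matrix (Fin m) (Fin m) ℝ) (hR : ∀ i, (R i).PosDef)
    (hLMI : (-(EventTriggered.phiE A B C K q h α σ P Ω W R)).PosSemidef) :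
    EventTriggered.ExponentiallyStabilizes A B C K q h Ω σ α :=
  theorem2_general (by omega) A B C (fun j hj => hdeg.1 j (by omega)) h hh q hq_pos K σ α hα.le P hP
    Ω W R hLMI
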